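/- Fix $1\le i\le d$ and let $m_1,\dots,m_{i-1}\in\mathbb Z^d\setminus\{0\}$ be row vectors with $m_{k,j}=0$ for $j>k$. Define polytopes in $\mathbb R^d$ by $P^{(1)}_{\mathbf m}=\{(1,0,\dots,0)\}$ and, for $2\le k\le i$, $$P^{(k)}_{\mathbf m}=\operatorname{conv}\Bigl(P^{(k-1)}_{\mathbf m}\cup\bigl\{(x_1,\dots,x_{k-1},\langle m_{k-1},x\rangle,0,\dots,0) : x\in P^{(k-1)}_{\mathbf m}\bigr\}\Bigr),$$ where $\langle m,x\rangle=\sum_j m_jx_j$. The sequence $\mathbf m=(m_1,\dots,m_{i-1})$ is admissible if $\langle m_{k-1},x\rangle\ge 0$ for all $x\in P^{(k-1)}_{\mathbf m}$ and all $2\le k\le i$. Let $L$ be a lattice (a discrete subgroup spanning the space) in a finite-dimensional real vector space $V$. A lattice polytope $P\subset V$ (the convex hull of a nonempty finite subset of $L$) is called a Nakajima polytope if, for some $1\le i\le d$ and some admissible $\mathbf m$ of length $i-1$, it is lattice equivalent to $P^{(i)}_{\mathbf m}\subset\mathbb R^d$ with respect to $\mathbb Z^d$; that is, there is an affine map $V\to\mathbb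 R^d$ that carries $P$ onto $P^{(i)}_{\mathbf m}$ and restricts to bijections $\operatorname{aff}(P)\to\operatorname{aff}(P^{(i)}_{\mathbf m})$ and $\operatorname{aff}(P)\cap L\to\operatorname{aff}(P^{(i)}_{\mathbf m})\cap\mathbb Z^d$. **Theorem.** Every Nakajima polytope $P$, of any dimension, admits a basic coherent lattice triangulation (b.c.-triangulation). That is, there is a finite simplicial complex $\mathcal T$ in $V$, pure of dimension $\dim P$, whose underlying space is $P$, whose vertices lie in $L$ and include the vertices of $P$, and which is * basic: the vertices of each simplex of $\mathcal T$ form part of an affine $\mathbb Z$-basis of $L$; * coherent: there is a polytope $Q\subset V\times\mathbb R$ whose image under the projection $\pi\colon V\times\mathbb R\to V$ is $P$, such that the (nonempty) simplices of $\mathcal T$ are exactly the sets $\pi(F)$ with $F$ a lower face of $Q$, i.e. the set of points of $Q$ at which some linear functional on $V\times\mathbb R$ with negative last coordinate attains its maximum over $Q$. -/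

import Mathlib

/-- `P` is a lattice polytope with respect to the lattice `L`: the convex hull of a nonempty finite
set of points of `L`. -/
def IsLatticePolytope {V : Type*} [AddCommGroup V] [Module ℝ V] (L : Submodule ℤ V)
    (P : Set V) : Prop :=
  ∃ T : Finset V, T.Nonempty ∧ (T : Set V) ⊆ (L : Set V) ∧ P = convexHull ℝ (T : Set V)

/-- Lattice equivalence of `P₁` (with respect to the lattice `L₁`) and `P₂` (with respect to the
lattice `L₂`): there is an affine map of the ambient spaces, taking `P₁` onto `P₂`, which maps the
affine hull of `P₁` bijectively onto that of `P₂` and the lattice points of the affine hull of `P₁`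
bijectively onto those of the affine hull of `P₂`. -/
def LatticeEquivalent {V₁ V₂ : Type*} [AddCommGroup V₁] [Module ℝ V₁]
    [AddCommGroup V₂] [Module ℝ V₂] (L₁ : Submodule ℤ V₁) (P₁ : Set V₁)
    (L₂ : Submodule ℤ V₂) (P₂ : Set V₂) : Prop :=
  ∃ f : V₁ →ᵃ[ℝ] V₂,
    Set.BijOn f (affineSpan ℝ P₁ : Set V₁) (affineSpan ℝ P₂ : Set V₂) ∧
    f '' P₁ = P₂ ∧
    Set.BijOn f ((affineSpan ℝ P₁ : Set V₁) ∩ (L₁ : Set V₁))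
      ((affineSpan ℝ P₂ : Set V₂) ∩ (L₂ : Set V₂))

/-- The standard lattice `ℤ^d` in `ℝ^d`. -/
def stdLattice (d : ℕ) : Submodule ℤ (Fin d → ℝ) :=
  Submodule.span ℤ (Set.range (Pi.basisFun ℝ (Fin d)))

/-- The pairing `⟨m, x⟩` of an integral row vector `m` with a point `x` of `ℝ^d`. -/
def rowPairing {d : ℕ} (m : Fin d → ℤ) (x : Fin d → ℝ) : ℝ :=
  ∑ j, (m j : ℝ) * x j

/-- The polytope in `ℝ^d` attached to a sequence `m` of `ℓ` integral row vectors (in the usual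
1-based notation this is `P_m^{(ℓ+1)}`). For `ℓ = 0` it is the point `(1, 0, …, 0)`. For `ℓ + 1`
rows it is the convex hull of the polytope `P` attached to the first `ℓ` rows and of the points
obtained from the points `x` of `P` by replacing the coordinate with (0-based) index `ℓ + 1`
by `⟨m_last, x⟩`. -/
def nakajimaModel {d : ℕ} : (ℓ : ℕ) → (Fin ℓ → Fin d → ℤ) → Set (Fin d → ℝ)
  | 0, _ => {fun j : Fin d => if (j : ℕ) = 0 then 1 else 0}
  | ℓ + 1, m =>
      convexHull ℝ (nakajimaModel ℓ (fun k => m k.castSucc) ∪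
        (fun (x : Fin d → ℝ) (j : Fin d) =>
          if (j : ℕ) = ℓ + 1 then rowPairing (m (Fin.last ℓ)) x else x j) ''
            nakajimaModel ℓ (fun k => m k.castSucc))

/-- `m` is an admissible sequence of free parameters: every row is nonzero, the row with (0-based)
index `k` vanishes in all coordinates of index larger than `k`, and it is nonnegative on the
polytope attached to the rows before it. -/
def IsAdmissible {d : ℕ} : (ℓ : ℕ) → (Fin ℓ → Fin d → ℤ) → Prop
  | 0, _ => True
  | ℓ + 1, m =>
      IsAdmissible ℓ (fun k => m k.castSucc) ∧
      m (Fin.last ℓ) ≠ 0 ∧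
      (∀ j : Fin d, ℓ < (j : ℕ) → m (Fin.last ℓ) j = 0) ∧
      ∀ x ∈ nakajimaModel ℓ (fun k => m k.castSucc), 0 ≤ rowPairing (m (Fin.last ℓ)) x

/-- A Nakajima polytope with respect to `L`: a lattice polytope that is lattice equivalent to the
polytope in some `ℝ^d` attached to an admissible sequence of at most `d - 1` free parameters. -/
def IsNakajimaPolytope {V : Type*} [AddCommGroup V] [Module ℝ V] (L : Submodule ℤ V)
    (P : Set V) : Prop :=
  IsLatticePolytope L P ∧
  ∃ (d ℓ : ℕ) (m : Fin ℓ → Fin d → ℤ), ℓ < d ∧ IsAdmissible ℓ m ∧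
    LatticeEquivalent L P (stdLattice d) (nakajimaModel ℓ m)

/-- The simplicial complex `K` is a triangulation of `P`: it has finitely many faces, its underlying
space is `P`, and it is pure of the dimension of `P`. -/
structure IsTriangulation {V : Type*} [AddCommGroup V] [Module ℝ V]
    (P : Set V) (K : Geometry.SimplicialComplex ℝ V) : Prop where
  finite : K.faces.Finite
  space_eq : K.space = P
  pure : ∀ s ∈ K.faces, ∃ t ∈ K.faces, s ⊆ t ∧
    t.card = Module.finrank ℝ (vectorSpan ℝ P) + 1

/-- A lattice triangulation of `P` with respect to `L`: all its vertices are in `L` (and the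
vertices of `P` are among them). -/
structure IsLatticeTriangulation {V : Type*} [AddCommGroup V] [Module ℝ V] (L : Submodule ℤ V)
    (P : Set V) (K : Geometry.SimplicialComplex ℝ V) : Prop extends IsTriangulation P K where
  vertices_subset : K.vertices ⊆ (L : Set V)
  extremePoints_subset : P.extremePoints ℝ ⊆ K.vertices

/-- The simplex with vertex set `s` is basic (unimodular) with respect to `L`: its vertices are part
of an affine `ℤ`-basis of `L`. -/
def IsBasicSimplex {V : Type*} [AddCommGroup V] (L : Submodule ℤ V) (s : Finset V) : Prop :=
  ∃ (n : ℕ) (b : AffineBasis (Fin n) ℤ L), (s : Set V) ⊆ Set.range (fun i => ((b i : L) : V))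

/-- The family `S` of nonempty polytopes (a subdivision of `P`, listed with all its nonempty
faces) is coherent: `P` is the projection of a polytope `Q` in `V × ℝ`, and the members of `S` are
exactly the projections of the lower faces of `Q`, a lower face being the set of points of `Q` at
which a linear functional with negative last coordinate attains its maximum over `Q`. -/
def IsCoherent {V : Type*} [NormedAddCommGroup V] [NormedSpace ℝ V]
    (P : Set V) (S : Set (Set V)) : Prop :=
  ∃ T : Finset (V × ℝ),
    Prod.fst '' convexHull ℝ (T : Set (V × ℝ)) = P ∧
    S = {C | ∃ φ : StrongDual ℝ (V × ℝ), φ (0, 1) < 0 ∧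
      C = Prod.fst '' φ.toExposed (convexHull ℝ (T : Set (V × ℝ)))}

/-- A b.c.-triangulation of `P` with respect to `L`: a lattice triangulation of `P` all of whose
simplices are basic, and which is coherent. -/
structure IsBCTriangulation {V : Type*} [NormedAddCommGroup V] [NormedSpace ℝ V]
    (L : Submodule ℤ V) (P : Set V) (K : Geometry.SimplicialComplex ℝ V) : Prop
    extends IsLatticeTriangulation L P K where
  basic : ∀ s ∈ K.faces, IsBasicSimplex L s
  coherent : IsCoherent P ((fun s : Finset V => convexHull ℝ (s : Set V)) '' K.faces)

/-!
A finite set `A` of points with heights `ω` induces a coherent subdivision of its convex hull, whose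
cells are the sets `lowerCell A ω u` of points at which `ω - u` is minimal, for linear functionals
`u`. If every point of `conv A` lies in the convex hull of a cell that is a basic simplex of full
dimension, then the cells are exactly the faces of a b.c.-triangulation
(`exists_isBCTriangulation_of_cover`): comparing heights shows that two cells meet in the hull of
their common points, a cell is contained in every cell that covers its barycentre, and subsets of an
affinely independent cell are cut out by perturbing `u`.

For the polytopes defining the Nakajima polytopes, such a configuration is built by induction on the
number of rows. The polytope of `ℓ + 1` rows is the region `0 ≤ t ≤ g x` over the polytope of the
first `ℓ` rows (`mem_nakajimaModel_succ`), with `g` the pairing with the last row, a nonnegative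
integer on `A`. The new configuration consists of all points `(a, j)` with `a ∈ A` and
`0 ≤ j ≤ g a`, and the new height of `(a, j)` is `M * ω a + ∑ i < j, d a i`, where
`d a 0 < d a 1 < ⋯` and all the increments `d a i` are different. For large `M` the new cells refine
the prisms over the old cells. Over a simplex `σ` the prism is subdivided by a staircase: as the
slope `s` in the direction of the fibre grows through the increments `d v j` with `v ∈ σ`, the
vertices of the cell move up, one fibre at a time and by one unit at a time
(`mem_lowerCell_fibre`), and these cells cover the prism (`exists_slope`). Each of them consists of
one point over every vertex of `σ` together with a second point over one vertex, so that it generates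
`Λ ⊔ ℤ e` if `σ` generates `Λ`. As all points have first coordinate `1`, linear generation of
`ℤ^{ℓ+1} × 0` by `ℓ + 1` vectors means that the simplex is unimodular.

A lattice equivalence carries the configuration over to `P`, and a simplex whose vertices generate
the lattice points of its affine hull is basic (`isBasicSimplex_of_forall_exists_sum`), because these
lattice points form a saturated sublattice.
-/

/-! ### Cells of a finite configuration and the triangulation they form -/

open scoped Classical in
/-- The cell cut out by the linear functional `u` from the configuration `A` with heights `ω`: the
points of `A` at which `ω - u` is minimal, that is, the points whose lifts `(a, ω a)` lie on the
supporting hyperplane of slope `u` from below. -/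
noncomputable def lowerCell {E : Type*} [AddCommGroup E] [Module ℝ E] (A : Finset E) (ω : E → ℝ)
    (u : E →ₗ[ℝ] ℝ) : Finset E :=
  A.filter fun a => ∀ b ∈ A, ω a - u a ≤ ω b - u b

section LowerCell

variable {E : Type*} [AddCommGroup E] [Module ℝ E] {A : Finset E} {ω : E → ℝ} {u u' : E →ₗ[ℝ] ℝ}

theorem mem_lowerCell {a : E} :
    a ∈ lowerCell A ω u ↔ a ∈ A ∧ ∀ b ∈ A, ω a - u a ≤ ω b - u b := by
  simp [lowerCell]

theorem lowerCell_subset : lowerCell A ω u ⊆ A := fun _ ha => (mem_lowerCell.1 ha).1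

theorem lowerCell_nonempty (hA : A.Nonempty) (u : E →ₗ[ℝ] ℝ) : (lowerCell A ω u).Nonempty := by
  obtain ⟨a, ha, h⟩ := A.exists_min_image (fun a => ω a - u a) hA
  exact ⟨a, mem_lowerCell.2 ⟨ha, h⟩⟩

/-- If a convex combination of the points of one cell lies in the convex hull of another cell, then
the points that occur in it belong to the other cell: the lower envelope of the lifted points over
the point in question is attained by both cells. -/
theorem mem_lowerCell_of_sum_mem_convexHull {w : E → ℝ} (hw : ∀ a ∈ lowerCell A ω u, 0 ≤ w a)
    (hw1 : ∑ a ∈ lowerCell A ω u, w a = 1)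
    (hx : ∑ a ∈ lowerCell A ω u, w a • a ∈ convexHull ℝ (lowerCell A ω u' : Set E))
    {a : E} (ha : a ∈ lowerCell A ω u) (hwa : w a ≠ 0) : a ∈ lowerCell A ω u' := by
  obtain ⟨w', hw', hw1', hx'⟩ := Finset.mem_convexHull'.1 hx
  have hne : (lowerCell A ω u').Nonempty := by
    by_contra h
    rw [Finset.not_nonempty_iff_eq_empty] at h
    simp [h] at hw1'
  obtain ⟨c', hc'⟩ := hne
  have e1 : ∑ b ∈ lowerCell A ω u, w b * (ω b - u b) = ω a - u a := by
    rw [← one_mul (ω a - u a), ← hw1, Finset.sum_mul]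
    refine Finset.sum_congr rfl fun b hb => ?_
    rw [le_antisymm ((mem_lowerCell.1 hb).2 a (lowerCell_subset ha))
      ((mem_lowerCell.1 ha).2 b (lowerCell_subset hb))]
  have e2 : ω a - u a ≤ ∑ b ∈ lowerCell A ω u', w' b * (ω b - u b) := by
    rw [← one_mul (ω a - u a), ← hw1', Finset.sum_mul]
    exact Finset.sum_le_sum fun b hb => mul_le_mul_of_nonneg_left
      ((mem_lowerCell.1 ha).2 b (lowerCell_subset hb)) (hw' b hb)
  have e3 : ∑ b ∈ lowerCell A ω u', w' b * (ω b - u' b) = ω c' - u' c' := by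
    rw [← one_mul (ω c' - u' c'), ← hw1', Finset.sum_mul]
    refine Finset.sum_congr rfl fun b hb => ?_
    rw [le_antisymm ((mem_lowerCell.1 hb).2 c' (lowerCell_subset hc'))
      ((mem_lowerCell.1 hc').2 b (lowerCell_subset hb))]
  have l1 := congrArg u hx'
  have l2 := congrArg u' hx'
  simp only [map_sum, map_smul, smul_eq_mul] at l1 l2
  simp only [mul_sub, Finset.sum_sub_distrib] at e1 e2 e3
  have key : ∑ b ∈ lowerCell A ω u, w b * ((ω b - u' b) - (ω c' - u' c')) ≤ 0 := by
    simp only [mul_sub, Finset.sum_sub_distrib, ← Finset.sum_mul, hw1]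
    linarith
  have hnn : ∀ b ∈ lowerCell A ω u, 0 ≤ w b * ((ω b - u' b) - (ω c' - u' c')) := fun b hb =>
    mul_nonneg (hw b hb) (sub_nonneg.2 ((mem_lowerCell.1 hc').2 b (lowerCell_subset hb)))
  have h0 := (Finset.sum_eq_zero_iff_of_nonneg hnn).1 (le_antisymm key (Finset.sum_nonneg hnn)) a ha
  have h1 := (mul_eq_zero.1 h0).resolve_left hwa
  refine mem_lowerCell.2 ⟨lowerCell_subset ha, fun b hb => ?_⟩
  have := (mem_lowerCell.1 hc').2 b hb
  linarith

theorem convexHull_lowerCell_inter_subset :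
    convexHull ℝ (lowerCell A ω u : Set E) ∩ convexHull ℝ (lowerCell A ω u' : Set E) ⊆
      convexHull ℝ (lowerCell A ω u ∩ lowerCell A ω u' : Set E) := by
  classical
  rintro x ⟨hx, hx'⟩
  obtain ⟨w, hw, hw1, rfl⟩ := Finset.mem_convexHull'.1 hx
  have hsupp : ∀ a ∈ lowerCell A ω u, a ∉ lowerCell A ω u ∩ lowerCell A ω u' → w a = 0 := by
    intro a ha ha'
    by_contra h
    exact ha' (Finset.mem_inter.2 ⟨ha, mem_lowerCell_of_sum_mem_convexHull hw hw1 hx' ha h⟩)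
  rw [← Finset.coe_inter, Finset.mem_convexHull']
  refine ⟨w, fun a ha => hw a (Finset.mem_inter.1 ha).1, ?_, ?_⟩
  · rw [Finset.sum_subset Finset.inter_subset_left hsupp, hw1]
  · exact Finset.sum_subset Finset.inter_subset_left fun a ha ha' => by rw [hsupp a ha ha', zero_smul]

/-- If the cells with the property `G` cover the convex hull of `A`, then every cell is contained in
one of them, namely in one that contains its barycentre. -/
theorem exists_lowerCell_superset (hA : A.Nonempty) {G : Finset E → Prop}
    (hcov : ∀ x ∈ convexHull ℝ (A : Set E), ∃ u : E →ₗ[ℝ] ℝ,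
      x ∈ convexHull ℝ (lowerCell A ω u : Set E) ∧ G (lowerCell A ω u)) (u : E →ₗ[ℝ] ℝ) :
    ∃ u' : E →ₗ[ℝ] ℝ, lowerCell A ω u ⊆ lowerCell A ω u' ∧ G (lowerCell A ω u') := by
  have hne := lowerCell_nonempty (ω := ω) hA u
  have hpos : (0 : ℝ) < (lowerCell A ω u).card := by exact_mod_cast hne.card_pos
  have hw : ∀ a ∈ lowerCell A ω u, (0 : ℝ) ≤ (fun _ : E => ((lowerCell A ω u).card : ℝ)⁻¹) a :=
    fun _ _ => (inv_pos.2 hpos).le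
  have hw1 : ∑ a ∈ lowerCell A ω u, (fun _ : E => ((lowerCell A ω u).card : ℝ)⁻¹) a = 1 := by
    simp [hpos.ne']
  obtain ⟨u', hx, hG⟩ := hcov _ (convexHull_mono (Finset.coe_subset.2 lowerCell_subset)
    (Finset.mem_convexHull'.2 ⟨_, hw, hw1, rfl⟩))
  exact ⟨u', fun a ha => mem_lowerCell_of_sum_mem_convexHull hw hw1 hx ha (inv_pos.2 hpos).ne', hG⟩

/-- An affinely independent set carries an affine functional that vanishes on a given subset and
is `-1` on the rest; only its linear part matters here. -/
theorem AffineIndependent.exists_linearMap_subset {t s : Finset E}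
    (ht : AffineIndependent ℝ ((↑) : t → E)) (hst : s ⊆ t) (hs : s.Nonempty) :
    ∃ (r : E →ₗ[ℝ] ℝ) (c : ℝ), (∀ a ∈ s, r a = c) ∧ ∀ a ∈ t, a ∉ s → r a = c - 1 := by
  classical
  obtain ⟨p, hp⟩ := hs
  have hli : LinearIndepOn ℝ id ((fun q : E => q -ᵥ p) '' ((t : Set E) \ {p})) :=
    (affineIndependent_set_iff_linearIndependent_vsub ℝ (s := (t : Set E)) (p₁ := p) (hst hp)).1 ht
  set B := Module.Basis.extend hli with hB
  let r : E →ₗ[ℝ] ℝ := B.constr ℝ fun v => if (v : E) + p ∈ s then 0 else -1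
  have hr : ∀ a ∈ t, a ≠ p → r (a - p) = if a ∈ s then 0 else -1 := by
    intro a ha hap
    have hmem : a - p ∈ (fun q : E => q -ᵥ p) '' ((t : Set E) \ {p}) := ⟨a, ⟨ha, hap⟩, rfl⟩
    have := B.constr_basis ℝ (fun v => if (v : E) + p ∈ s then (0 : ℝ) else -1)
      ⟨a - p, hli.subset_extend (Set.subset_univ _) hmem⟩
    rw [Module.Basis.extend_apply_self] at this
    simpa using this
  refine ⟨r, r p, fun a ha => ?_, fun a ha has => ?_⟩
  · by_cases hap : a = p
    · rw [hap]
    · have := hr a (hst ha) hap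
      rw [map_sub, if_pos ha] at this
      linarith
  · have hap : a ≠ p := fun h => has (h ▸ hp)
    have := hr a ha hap
    rw [map_sub, if_neg has] at this
    linarith

/-- Every nonempty subset of an affinely independent cell is a cell, by a small perturbation of the
functional. -/
theorem exists_lowerCell_eq {s : Finset E} (hs : s.Nonempty) (hsu : s ⊆ lowerCell A ω u)
    (hu : AffineIndependent ℝ ((↑) : lowerCell A ω u → E)) :
    ∃ u' : E →ₗ[ℝ] ℝ, lowerCell A ω u' = s := by
  obtain ⟨r, c, hr, hr'⟩ := hu.exists_linearMap_subset hsu hs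
  obtain ⟨p, hp⟩ := hs
  have hpu := mem_lowerCell.1 (hsu hp)
  have hev : ∀ᶠ ε : ℝ in nhdsWithin 0 (Set.Ioi 0),
      ∀ a ∈ A, a ∉ lowerCell A ω u → ε * (r a - c) < (ω a - u a) - (ω p - u p) := by
    rw [Filter.eventually_all_finset]
    intro a ha
    by_cases hau : a ∈ lowerCell A ω u
    · simp [hau]
    · have hlt : 0 < (ω a - u a) - (ω p - u p) := by
        by_contra hcon
        exact hau (mem_lowerCell.2 ⟨ha, fun b hb => by linarith [hpu.2 b hb]⟩)
      have ht : Filter.Tendsto (fun ε : ℝ => ε * (r a - c)) (nhdsWithin 0 (Set.Ioi 0))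
          (nhds (0 * (r a - c))) :=
        ((continuous_id.mul continuous_const).tendsto _).mono_left nhdsWithin_le_nhds
      rw [zero_mul] at ht
      filter_upwards [ht.eventually_lt_const hlt] with ε hε _ using hε
  obtain ⟨ε, hε, hε0⟩ := (hev.and self_mem_nhdsWithin).exists
  have hε0 : 0 < ε := hε0
  have hval : ∀ a ∈ A, a ∉ s → (ω p - u p) - ε * c < ω a - u a - ε * r a := by
    intro a ha has
    by_cases hau : a ∈ lowerCell A ω u
    · rw [hr' a hau has]
      have := hpu.2 a ha
      linarith
    · have := hε a ha hau
      linarith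
  have hvals : ∀ a ∈ s, ω a - u a - ε * r a = (ω p - u p) - ε * c := by
    intro a ha
    rw [hr a ha]
    have h1 := (mem_lowerCell.1 (hsu ha)).2 p hpu.1
    have h2 := hpu.2 a (lowerCell_subset (hsu ha))
    linarith
  refine ⟨u + ε • r, Finset.ext fun a => ⟨fun ha => ?_, fun ha => ?_⟩⟩
  · by_contra has
    have h1 := hval a (lowerCell_subset ha) has
    have h2 := (mem_lowerCell.1 ha).2 p hpu.1
    have h3 := hvals p hp
    simp only [LinearMap.add_apply, LinearMap.smul_apply, smul_eq_mul] at h2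
    linarith
  · refine mem_lowerCell.2 ⟨lowerCell_subset (hsu ha), fun b hb => ?_⟩
    simp only [LinearMap.add_apply, LinearMap.smul_apply, smul_eq_mul]
    have h1 := hvals a ha
    by_cases hbs : b ∈ s
    · have := hvals b hbs
      linarith
    · have := hval b hb hbs
      linarith

end LowerCell

/-- The maximum of a linear functional over the convex hull of a finite set is attained exactly on
the convex hull of the points of the set at which it is attained. -/
theorem toExposed_convexHull {W : Type*} [AddCommGroup W] [Module ℝ W] [TopologicalSpace W]
    (φ : StrongDual ℝ W) (T : Finset W) :
    φ.toExposed (convexHull ℝ (T : Set W)) =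
      convexHull ℝ {y | y ∈ T ∧ ∀ b ∈ T, φ b ≤ φ y} := by
  classical
  ext x
  constructor
  · rintro ⟨hx, hmax⟩
    obtain ⟨w, hw, hw1, rfl⟩ := Finset.mem_convexHull'.1 hx
    set x := ∑ y ∈ T, w y • y with hxdef
    have hsum : ∑ y ∈ T, w y * (φ x - φ y) = 0 := by
      simp only [mul_sub, Finset.sum_sub_distrib, ← Finset.sum_mul, hw1, hxdef, map_sum, map_smul,
        smul_eq_mul, one_mul, sub_self]
    have h0 := (Finset.sum_eq_zero_iff_of_nonneg fun y hy => mul_nonneg (hw y hy)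
      (sub_nonneg.2 (hmax y (subset_convexHull ℝ _ hy)))).1 hsum
    have hfil : ∑ y ∈ T with w y ≠ 0, w y • y = x :=
      Finset.sum_filter_of_ne fun y _ hne hwy => hne (by rw [hwy, zero_smul])
    rw [← hfil]
    refine (convex_convexHull ℝ {y | y ∈ T ∧ ∀ b ∈ T, φ b ≤ φ y}).sum_mem
      (fun y hy => hw y (Finset.mem_filter.1 hy).1) ((Finset.sum_filter_ne_zero T).trans hw1) ?_
    intro y hy
    obtain ⟨hy, hwy⟩ := Finset.mem_filter.1 hy
    refine subset_convexHull ℝ _ ⟨hy, fun b hb => ?_⟩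
    have := (mul_eq_zero.1 (h0 y hy)).resolve_left hwy
    linarith [hmax b (subset_convexHull ℝ _ hb)]
  · intro hx
    refine ⟨convexHull_mono (fun y hy => hy.1) hx, fun y hy => ?_⟩
    have h1 : convexHull ℝ {y | y ∈ T ∧ ∀ b ∈ T, φ b ≤ φ y} ⊆ {z | ∀ b ∈ T, φ b ≤ φ z} := by
      refine convexHull_min (fun z hz => hz.2) ?_
      intro z hz z' hz' s t hs ht hst b hb
      rw [map_add, map_smul, map_smul, smul_eq_mul, smul_eq_mul]
      calc φ b = s * φ b + t * φ b := by rw [← add_mul, hst, one_mul]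
        _ ≤ s * φ z + t * φ z' := add_le_add (mul_le_mul_of_nonneg_left (hz b hb) hs)
            (mul_le_mul_of_nonneg_left (hz' b hb) ht)
    have h2 : convexHull ℝ (T : Set W) ⊆ {z | φ z ≤ φ x} :=
      convexHull_min (fun z hz => h1 hx z hz) (convex_halfSpace_le φ.toLinearMap.isLinear _)
    exact h2 hy

theorem IsBasicSimplex.subset {V : Type*} [AddCommGroup V] {L : Submodule ℤ V} {s t : Finset V} (ht : IsBasicSimplex L t)
    (hst : s ⊆ t) : IsBasicSimplex L s := by
  obtain ⟨n, b, hb⟩ := ht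
  exact ⟨n, b, (Finset.coe_subset.2 hst).trans hb⟩

section Triangulation

variable {V : Type*} [NormedAddCommGroup V] [NormedSpace ℝ V]

theorem isCoherent_lowerCell [FiniteDimensional ℝ V] (A : Finset V) (ω : V → ℝ) :
    IsCoherent (convexHull ℝ (A : Set V))
      {C | ∃ u : V →ₗ[ℝ] ℝ, C = convexHull ℝ (lowerCell A ω u : Set V)} := by
  classical
  have hproj : ∀ S : Set (V × ℝ), Prod.fst '' convexHull ℝ S = convexHull ℝ (Prod.fst '' S) :=
    fun S => (LinearMap.fst ℝ V ℝ).image_convexHull S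
  refine ⟨A.image fun a => (a, ω a), ?_, ?_⟩
  · rw [hproj]
    congr 1
    ext x
    simp
  · -- The functional `φ` and the slope `u` correspond by `φ (v, t) = κ (u v - t)` with `κ > 0`.
    have hface : ∀ (φ : StrongDual ℝ (V × ℝ)) (u : V →ₗ[ℝ] ℝ) (κ : ℝ), 0 < κ →
        (∀ v t, φ (v, t) = κ * (u v - t)) →
        Prod.fst '' φ.toExposed (convexHull ℝ ((A.image fun a => (a, ω a) : Finset (V × ℝ)) :
          Set (V × ℝ))) = convexHull ℝ (lowerCell A ω u : Set V) := by
      intro φ u κ hκ hφ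
      rw [toExposed_convexHull, hproj]
      congr 1
      ext x
      have : ∀ a b : V, φ (b, ω b) ≤ φ (a, ω a) ↔ ω a - u a ≤ ω b - u b := by
        intro a b
        rw [hφ, hφ, mul_le_mul_iff_right₀ hκ]
        constructor <;> intro h <;> linarith
      constructor
      · rintro ⟨y, ⟨hy, hmax⟩, rfl⟩
        obtain ⟨a, ha, rfl⟩ := Finset.mem_image.1 hy
        exact mem_lowerCell.2 ⟨ha, fun b hb =>
          (this a b).1 (hmax _ (Finset.mem_image_of_mem _ hb))⟩
      · intro hx
        obtain ⟨hxA, hx⟩ := mem_lowerCell.1 hx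
        refine ⟨(x, ω x), ⟨Finset.mem_image_of_mem _ hxA, fun b hb => ?_⟩, rfl⟩
        obtain ⟨c, hc, rfl⟩ := Finset.mem_image.1 hb
        exact (this x c).2 (hx c hc)
    ext C
    constructor
    · rintro ⟨u, rfl⟩
      have hφ : ∀ v t, (u.toContinuousLinearMap.comp (ContinuousLinearMap.fst ℝ V ℝ) -
          ContinuousLinearMap.snd ℝ V ℝ) (v, t) = 1 * (u v - t) := fun v t => by simp
      refine ⟨_, ?_, (hface _ u 1 one_pos hφ).symm⟩
      rw [hφ]
      simp
    · rintro ⟨φ, hφ, rfl⟩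
      refine ⟨(-φ (0, 1))⁻¹ • (φ.toLinearMap.comp (LinearMap.inl ℝ V ℝ)),
        hface φ _ (-φ (0, 1)) (neg_pos.2 hφ) fun v t => ?_⟩
      have hsplit : φ (v, t) = φ (v, 0) + t * φ (0, 1) := by
        rw [← smul_eq_mul, ← map_smul, ← map_add]
        simp
      have h0 : φ (0, 1) ≠ 0 := hφ.ne
      simp only [LinearMap.smul_apply, LinearMap.comp_apply, LinearMap.inl_apply,
        ContinuousLinearMap.coe_coe, smul_eq_mul, hsplit]
      field_simp
      ring

/-- A finite configuration `A ⊆ L` with heights `ω` whose full-dimensional basic simplicial cells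
cover the convex hull of `A` induces a b.c.-triangulation: its faces are all the cells. -/
theorem exists_isBCTriangulation_of_cover [FiniteDimensional ℝ V] {L : Submodule ℤ V}
    {A : Finset V} (ω : V → ℝ) (hA : A.Nonempty) (hAL : (A : Set V) ⊆ L)
    (hcov : ∀ x ∈ convexHull ℝ (A : Set V), ∃ u : V →ₗ[ℝ] ℝ,
      x ∈ convexHull ℝ (lowerCell A ω u : Set V) ∧
        AffineIndependent ℝ ((↑) : lowerCell A ω u → V) ∧
        (lowerCell A ω u).card =
          Module.finrank ℝ (vectorSpan ℝ (convexHull ℝ (A : Set V))) + 1 ∧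
        IsBasicSimplex L (lowerCell A ω u)) :
    ∃ K : Geometry.SimplicialComplex ℝ V, IsBCTriangulation L (convexHull ℝ (A : Set V)) K := by
  have hsup := exists_lowerCell_superset hA (G := fun s => AffineIndependent ℝ ((↑) : s → V) ∧
    s.card = Module.finrank ℝ (vectorSpan ℝ (convexHull ℝ (A : Set V))) + 1 ∧
    IsBasicSimplex L s) hcov
  have hind : ∀ u, AffineIndependent ℝ ((↑) : lowerCell A ω u → V) := by
    intro u
    obtain ⟨u', hu', h, -⟩ := hsup u
    exact h.mono (Finset.coe_subset.2 hu')
  let K : Geometry.SimplicialComplex ℝ V :=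
    { faces := Set.range (lowerCell A ω)
      isRelLowerSet_faces := by
        rintro _ ⟨u, rfl⟩
        refine ⟨lowerCell_nonempty hA u, fun t ht htne => ?_⟩
        exact exists_lowerCell_eq htne ht (hind u)
      indep := by
        rintro _ ⟨u, rfl⟩
        exact hind u
      inter_subset_convexHull := by
        rintro _ _ ⟨u, rfl⟩ ⟨u', rfl⟩
        exact convexHull_lowerCell_inter_subset }
  have hK : K.faces = Set.range (lowerCell A ω) := rfl
  refine ⟨K, ⟨⟨⟨?_, ?_, ?_⟩, ?_, ?_⟩, ?_, ?_⟩⟩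
  · refine A.powerset.finite_toSet.subset ?_
    rintro _ ⟨u, rfl⟩
    exact Finset.mem_coe.2 (Finset.mem_powerset.2 lowerCell_subset)
  · refine Set.Subset.antisymm ?_ fun x hx => ?_
    · refine Set.iUnion₂_subset ?_
      rintro _ ⟨u, rfl⟩
      exact convexHull_mono (Finset.coe_subset.2 lowerCell_subset)
    · obtain ⟨u, hxu, -⟩ := hcov x hx
      exact Geometry.SimplicialComplex.mem_space_iff.2 ⟨_, ⟨u, rfl⟩, hxu⟩
  · rintro _ ⟨u, rfl⟩
    obtain ⟨u', hu', -, h, -⟩ := hsup u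
    exact ⟨_, ⟨u', rfl⟩, hu', h⟩
  · rw [Geometry.SimplicialComplex.vertices_eq]
    refine Set.iUnion₂_subset ?_
    rintro _ ⟨u, rfl⟩
    exact (Finset.coe_subset.2 lowerCell_subset).trans hAL
  · intro x hx
    obtain ⟨u, hxu, -⟩ := hcov x hx.1
    have hx' : x ∈ (convexHull ℝ (lowerCell A ω u : Set V)).extremePoints ℝ :=
      inter_extremePoints_subset_extremePoints_of_subset
        (convexHull_mono (Finset.coe_subset.2 lowerCell_subset)) ⟨hxu, hx⟩
    rw [Geometry.SimplicialComplex.vertices_eq]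
    exact Set.mem_iUnion₂.2 ⟨_, ⟨u, rfl⟩, extremePoints_convexHull_subset hx'⟩
  · rintro _ ⟨u, rfl⟩
    obtain ⟨u', hu', -, -, h⟩ := hsup u
    exact h.subset hu'
  · convert isCoherent_lowerCell A ω using 1
    ext C
    constructor
    · rintro ⟨_, ⟨u, rfl⟩, rfl⟩
      exact ⟨u, rfl⟩
    · rintro ⟨u, rfl⟩
      exact ⟨_, ⟨u, rfl⟩, rfl⟩

end Triangulation

/-! ### Basic simplices -/

/-- A point `p` of a module together with its translates by the vectors of a basis form an affine
basis. -/
theorem Module.Basis.exists_affineBasis {R M ι : Type*} [Ring R] [AddCommGroup M] [Module R M]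
    (b : Module.Basis ι R M) (p : M) :
    ∃ B : AffineBasis (Option ι) R M, B none = p ∧ ∀ i, B (some i) = b i + p := by
  let q : Option ι → M := fun o => o.elim p fun i => b i + p
  have hq : ∀ i, q (some i) -ᵥ q none = b i := fun i => by simp [q]
  have hind : AffineIndependent R q := by
    rw [affineIndependent_iff_linearIndependent_vsub R q none]
    let e : {x : Option ι // x ≠ none} ≃ ι :=
      (Equiv.subtypeEquivRight fun x => Option.ne_none_iff_isSome).trans (Equiv.optionIsSomeEquiv ι)
    have : (fun i : {x // x ≠ none} => q i -ᵥ q none) = b ∘ e := by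
      funext ⟨x, hx⟩
      obtain ⟨i, rfl⟩ := Option.ne_none_iff_exists'.1 hx
      exact hq i
    rw [this]
    exact b.linearIndependent.comp _ e.injective
  have htop : affineSpan R (Set.range q) = ⊤ := by
    rw [AffineSubspace.affineSpan_eq_top_iff_vectorSpan_eq_top_of_nonempty R M M
      (Set.range_nonempty q), eq_top_iff, ← b.span_eq, Submodule.span_le]
    rintro _ ⟨i, rfl⟩
    rw [← hq i]
    exact vsub_mem_vectorSpan R (Set.mem_range_self _) (Set.mem_range_self _)
  exact ⟨⟨q, hind, htop⟩, rfl, fun i => rfl⟩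

/-- A simplex with vertices in `L` is basic as soon as its vertices generate the lattice points of
its affine hull by integral affine combinations: those lattice points form a saturated affine
sublattice, so that a basis of its direction extends to a basis of `L`. -/
theorem isBasicSimplex_of_forall_exists_sum {V : Type*} [NormedAddCommGroup V] [NormedSpace ℝ V]
    [FiniteDimensional ℝ V] (L : Submodule ℤ V) [DiscreteTopology L] [IsZLattice ℝ L]
    {s : Finset V} (hs : s.Nonempty) (hsL : (s : Set V) ⊆ L)
    (hind : AffineIndependent ℝ ((↑) : s → V))
    (hZ : ∀ y ∈ L, y ∈ affineSpan ℝ (s : Set V) →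
      ∃ n : V → ℤ, ∑ v ∈ s, n v = 1 ∧ ∑ v ∈ s, n v • v = y) :
    IsBasicSimplex L s := by
  classical
  obtain ⟨p, hp⟩ := hs
  have hpL : p ∈ L := hsL hp
  have : Module.Finite ℤ L := ZLattice.module_finite ℝ L
  have : Module.Free ℤ L := ZLattice.module_free ℝ L
  let W : Submodule ℝ V := vectorSpan ℝ (s : Set V)
  let F : L →ₗ[ℤ] V ⧸ W := (W.mkQ.restrictScalars ℤ) ∘ₗ L.subtype
  have hF : ∀ y : L, y ∈ LinearMap.ker F ↔ (y : V) ∈ W := fun y => by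
    simp [F]
  let w : s.erase p → LinearMap.ker F := fun v =>
    ⟨⟨v - p, L.sub_mem (hsL (Finset.mem_of_mem_erase v.2)) hpL⟩,
      (hF _).2 (vsub_mem_vectorSpan ℝ (Finset.mem_coe.2 (Finset.mem_of_mem_erase v.2)) (Finset.mem_coe.2 hp))⟩
  have hwind : LinearIndependent ℤ w := by
    refine LinearIndependent.of_comp (L.subtype ∘ₗ (LinearMap.ker F).subtype) ?_
    have h1 := (affineIndependent_iff_linearIndependent_vsub ℝ _ (⟨p, hp⟩ : s)).1 hind
    have h2 := h1.comp (fun v : s.erase p =>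
      (⟨⟨v, Finset.mem_of_mem_erase v.2⟩,
        fun h => Finset.ne_of_mem_erase v.2 (congrArg Subtype.val h)⟩ : {x : s // x ≠ ⟨p, hp⟩}))
      (fun v v' h => Subtype.ext (congrArg (fun x => (x.1.1 : V)) h))
    exact h2.restrict_scalars' ℤ
  have hwtop : ⊤ ≤ Submodule.span ℤ (Set.range w) := by
    rintro y -
    have hyW : ((y : L) : V) ∈ W := (hF _).1 y.2
    obtain ⟨n, hn1, hn⟩ := hZ (y + p) (L.add_mem (y : L).2 hpL) (by
      have := AffineSubspace.vadd_mem_of_mem_direction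
        (by rwa [direction_affineSpan] : ((y : L) : V) ∈ (affineSpan ℝ (s : Set V)).direction)
        (subset_affineSpan ℝ (s : Set V) hp)
      rwa [vadd_eq_add] at this)
    have hy : y = ∑ v : s.erase p, n v • w v := by
      apply Subtype.ext
      apply Subtype.ext
      have e1 : ((y : L) : V) = ∑ v ∈ s, n v • (v - p) := by
        simp only [smul_sub, Finset.sum_sub_distrib, ← Finset.sum_smul, hn1, hn, one_smul,
          add_sub_cancel_right]
      have e2 : ∑ v ∈ s, n v • (v - p) = ∑ v ∈ s.erase p, n v • (v - p) :=
        (Finset.sum_erase _ (by rw [sub_self, smul_zero])).symm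
      rw [e1, e2, ← Finset.sum_coe_sort]
      simp [w]
    rw [hy]
    exact Submodule.sum_mem _ fun v _ =>
      Submodule.smul_mem _ _ (Submodule.subset_span (Set.mem_range_self v))
  let bN : Module.Basis _ ℤ (LinearMap.ker F) := Module.Basis.mk hwind hwtop
  have : Module.IsTorsionFree ℤ (V ⧸ W) := Module.IsTorsionFree.trans ℝ
  have : Module.IsTorsionFree ℤ (LinearMap.range F) :=
    Function.Injective.moduleIsTorsionFree _ Subtype.val_injective fun _ _ => rfl
  have : Module.Free ℤ (L ⧸ LinearMap.ker F) :=
    Module.Free.of_equiv F.quotKerEquivRange.symm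
  let bQ := Module.Free.chooseBasis ℤ (L ⧸ LinearMap.ker F)
  let b := Module.Basis.sumQuot bN bQ
  obtain ⟨B, hB0, hB⟩ := b.exists_affineBasis (⟨p, hpL⟩ : L)
  let e := Fintype.equivFin (Option (s.erase p ⊕
    Module.Free.ChooseBasisIndex ℤ (L ⧸ LinearMap.ker F)))
  refine ⟨_, B.reindex e, fun v hv => ?_⟩
  by_cases hvp : v = p
  · refine ⟨e none, ?_⟩
    simp [hB0, hvp]
  · refine ⟨e (some (Sum.inl ⟨v, Finset.mem_erase.2 ⟨hvp, hv⟩⟩)), ?_⟩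
    simp [hB, b, bN, w]

/-! ### Staircases over a simplex -/

section Staircase

theorem Nat.lt_count_iff_of_antitone {p : ℕ → Prop} [DecidablePred p]
    (hp : ∀ i j, i ≤ j → p j → p i) (h i : ℕ) : i < Nat.count p h ↔ i < h ∧ p i := by
  induction h with
  | zero => simp
  | succ h ih =>
    rw [Nat.count_succ]
    split_ifs with hph
    · have hall : Nat.count p h = h := (Nat.count_iff_forall).2 fun j hj => hp j h hj.le hph
      rw [hall]
      exact ⟨fun hi => ⟨hi, hp i h (Nat.lt_succ_iff.1 hi) hph⟩, fun hi => hi.1⟩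
    · rw [add_zero, ih]
      refine ⟨fun ⟨h1, h2⟩ => ⟨h1.trans (Nat.lt_succ_self h), h2⟩, fun ⟨h1, h2⟩ => ⟨?_, h2⟩⟩
      rcases Nat.lt_succ_iff_lt_or_eq.1 h1 with h1 | rfl
      · exact h1
      · exact absurd h2 hph

variable {d : ℕ → ℕ} {h s : ℕ}

/-- The height in a fibre of length `h` at which the slopes `d 0 < d 1 < ⋯` of a convex function
reach `s`: the number of `i < h` with `d i < s`. -/
def levelAt (d : ℕ → ℕ) (h s : ℕ) : ℕ :=
  Nat.count (fun i => d i < s) h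

/-- The value at `j` of the convex function with `f 0 = 0` and increments `d i`, tilted by the
slope `s`. -/
def tiltedSum (d : ℕ → ℕ) (s j : ℕ) : ℝ :=
  ∑ i ∈ Finset.range j, ((d i : ℝ) - s)

theorem lt_levelAt_iff (hd : StrictMono d) {i : ℕ} : i < levelAt d h s ↔ i < h ∧ d i < s :=
  Nat.lt_count_iff_of_antitone (fun _ _ hij hj => (hd.monotone hij).trans_lt hj) h i

theorem levelAt_le : levelAt d h s ≤ h :=
  Nat.count_le _

theorem levelAt_eq_self (hs : ∀ i < h, d i < s) : levelAt d h s = h :=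
  Nat.count_iff_forall.2 hs

theorem levelAt_le_succ (hd : StrictMono d) : levelAt d h s ≤ levelAt d h (s + 1) := by
  by_contra! hlt
  have h1 := (lt_levelAt_iff hd).1 hlt
  exact lt_irrefl _ ((lt_levelAt_iff hd).2 ⟨h1.1, h1.2.trans (Nat.lt_succ_self s)⟩)

theorem levelAt_apply (hd : StrictMono d) {j : ℕ} (hj : j < h) : levelAt d h (d j) = j := by
  refine eq_of_forall_lt_iff fun i => ?_
  rw [lt_levelAt_iff hd, hd.lt_iff_lt]
  exact ⟨fun hi => hi.2, fun hi => ⟨hi.trans hj, hi⟩⟩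

theorem levelAt_apply_succ (hd : StrictMono d) {j : ℕ} (hj : j < h) :
    levelAt d h (d j + 1) = j + 1 := by
  refine eq_of_forall_lt_iff fun i => ?_
  rw [lt_levelAt_iff hd, Nat.lt_succ_iff, hd.le_iff_le, Nat.lt_succ_iff]
  exact ⟨fun hi => hi.2, fun hi => ⟨hi.trans_lt hj, hi⟩⟩

theorem levelAt_succ_of_forall_ne (hd : StrictMono d) (hs : ∀ i < h, d i ≠ s) :
    levelAt d h (s + 1) = levelAt d h s := by
  refine eq_of_forall_lt_iff fun i => ?_
  rw [lt_levelAt_iff hd, lt_levelAt_iff hd, Nat.lt_succ_iff]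
  exact ⟨fun hi => ⟨hi.1, hi.2.lt_of_ne (hs i hi.1)⟩, fun hi => ⟨hi.1, hi.2.le⟩⟩

theorem tiltedSum_levelAt_le (hd : StrictMono d) {j : ℕ} (hj : j ≤ h) :
    tiltedSum d s (levelAt d h s) ≤ tiltedSum d s j := by
  rcases le_total (levelAt d h s) j with hle | hle
  · rw [← sub_nonneg, tiltedSum, tiltedSum, ← Finset.sum_Ico_eq_sub _ hle]
    refine Finset.sum_nonneg fun i hi => ?_
    obtain ⟨hi1, hi2⟩ := Finset.mem_Ico.1 hi
    have : ¬ d i < s := fun hlt =>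
      hi1.not_gt ((lt_levelAt_iff hd).2 ⟨hi2.trans_le hj, hlt⟩)
    rw [sub_nonneg]
    exact_mod_cast not_lt.1 this
  · rw [← sub_nonpos, tiltedSum, tiltedSum, ← Finset.sum_Ico_eq_sub _ hle]
    refine Finset.sum_nonpos fun i hi => ?_
    rw [sub_nonpos]
    exact_mod_cast ((lt_levelAt_iff hd).1 (Finset.mem_Ico.1 hi).2).2.le

/-- The tilted convex function is minimal exactly between the two levels of the slope. -/
theorem tiltedSum_le_iff (hd : StrictMono d) {j : ℕ} (hj : j ≤ h) :
    tiltedSum d s j ≤ tiltedSum d s (levelAt d h s) ↔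
      levelAt d h s ≤ j ∧ j ≤ levelAt d h (s + 1) := by
  constructor
  · intro hle
    constructor
    · by_contra! hlt
      refine hle.not_gt ?_
      rw [← sub_neg, tiltedSum, tiltedSum, ← Finset.sum_Ico_eq_sub _ hlt.le]
      refine Finset.sum_neg (fun i hi => ?_) (Finset.nonempty_Ico.2 hlt)
      rw [sub_neg]
      exact_mod_cast ((lt_levelAt_iff hd).1 (Finset.mem_Ico.1 hi).2).2
    · by_contra! hlt
      refine hle.not_gt ((tiltedSum_levelAt_le hd (hlt.le.trans hj)).trans_lt ?_)
      rw [← sub_pos, tiltedSum, tiltedSum, ← Finset.sum_Ico_eq_sub _ hlt.le]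
      refine Finset.sum_pos (fun i hi => ?_) (Finset.nonempty_Ico.2 hlt)
      obtain ⟨hi1, hi2⟩ := Finset.mem_Ico.1 hi
      have : ¬ d i < s + 1 := fun h' =>
        hi1.not_gt ((lt_levelAt_iff hd).2 ⟨hi2.trans_le hj, h'⟩)
      rw [sub_pos]
      exact_mod_cast (not_lt.1 this)
  · rintro ⟨h1, h2⟩
    rw [← sub_nonpos, tiltedSum, tiltedSum, ← Finset.sum_Ico_eq_sub _ h1]
    refine Finset.sum_nonpos fun i hi => ?_
    rw [sub_nonpos]
    exact_mod_cast Nat.lt_succ_iff.1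
      ((lt_levelAt_iff hd).1 ((Finset.mem_Ico.1 hi).2.trans_le h2)).2

/-- The weighted levels `∑ w v * levelAt (d v) (h v) s` and `∑ w v * levelAt (d v) (h v) (s + 1)`,
where `s` runs through the slopes that occur, bound intervals that cover the weighted fibre. -/
theorem exists_slope {ι : Type*} {σ : Finset ι} {d : ι → ℕ → ℕ} {h : ι → ℕ} {w : ι → ℝ} {t : ℝ}
    (hd : ∀ v ∈ σ, StrictMono (d v)) (hpos : ∃ v ∈ σ, 0 < h v) (ht0 : 0 ≤ t)
    (ht : t ≤ ∑ v ∈ σ, w v * h v) :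
    ∃ v₀ ∈ σ, ∃ j₀ < h v₀, ∑ v ∈ σ, w v * levelAt (d v) (h v) (d v₀ j₀) ≤ t ∧
      t ≤ ∑ v ∈ σ, w v * levelAt (d v) (h v) (d v₀ j₀ + 1) := by
  classical
  obtain ⟨v₁, hv₁, hh₁⟩ := hpos
  let Q : ℕ → Prop := fun s => (∃ v ∈ σ, ∃ j < h v, d v j ≤ s) ∧
    t ≤ ∑ v ∈ σ, w v * levelAt (d v) (h v) (s + 1)
  have hQ : ∃ s, Q s := by
    refine ⟨∑ v ∈ σ, d v (h v), ⟨v₁, hv₁, 0, hh₁, ?_⟩, ht.trans_eq ?_⟩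
    · exact ((hd v₁ hv₁).monotone (Nat.zero_le _)).trans
        (Finset.single_le_sum (f := fun v => d v (h v)) (fun _ _ => Nat.zero_le _) hv₁)
    · refine Finset.sum_congr rfl fun v hv => ?_
      rw [levelAt_eq_self fun i hi => ?_]
      exact Nat.lt_succ_iff.2 (((hd v hv).monotone hi.le).trans
        (Finset.single_le_sum (f := fun v => d v (h v)) (fun _ _ => Nat.zero_le _) hv))
  obtain ⟨⟨v, hv, j, hj, hvj⟩, hts⟩ := Nat.find_spec hQ
  have hmin := fun s' hs' => Nat.find_min hQ (m := s') hs'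
  set s := Nat.find hQ with hs
  by_cases hocc : ∃ v ∈ σ, ∃ j < h v, d v j = s
  · obtain ⟨v₀, hv₀, j₀, hj₀, hs₀⟩ := hocc
    refine ⟨v₀, hv₀, j₀, hj₀, ?_, by rwa [hs₀]⟩
    rw [hs₀]
    by_contra! hlt
    -- A slope smaller than `s` occurs, since the lower level at `s` is positive.
    obtain ⟨v', hv', hne⟩ := Finset.exists_ne_zero_of_sum_ne_zero (ht0.trans_lt hlt).ne'
    have hlev : 0 < levelAt (d v') (h v') s :=
      Nat.pos_of_ne_zero fun h0 => hne (by rw [h0, Nat.cast_zero, mul_zero])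
    obtain ⟨hh', hd'⟩ := (lt_levelAt_iff (hd v' hv')).1 hlev
    obtain ⟨s', hs'⟩ : ∃ s', s = s' + 1 := ⟨s - 1, by omega⟩
    refine hmin s' (by omega) ⟨⟨v', hv', 0, hh', by omega⟩, ?_⟩
    rw [← hs']
    exact hlt.le
  · -- Otherwise the predecessor of `s` would do as well.
    have hlt : d v j < s := hvj.lt_of_ne fun h => hocc ⟨v, hv, j, hj, h⟩
    obtain ⟨s', hs'⟩ : ∃ s', s = s' + 1 := ⟨s - 1, by omega⟩
    refine absurd ⟨⟨v, hv, j, hj, by omega⟩, ?_⟩ (hmin s' (by omega))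
    rw [← hs']
    refine hts.trans_eq (Finset.sum_congr rfl fun v hv => ?_)
    rw [levelAt_succ_of_forall_ne (hd v hv) fun i hi h => hocc ⟨v, hv, i, hi, h⟩]

end Staircase

section Fibre

variable {E : Type*} [AddCommGroup E] [Module ℝ E]

open scoped Classical in
/-- The points `a + j • e` with `a ∈ A` and `0 ≤ j ≤ h a`. -/
noncomputable def fibrePoints (A : Finset E) (h : E → ℕ) (e : E) : Finset E :=
  A.biUnion fun a => (Finset.range (h a + 1)).image fun j : ℕ => a + (j : ℝ) • e

/-- The projection along `e` onto the kernel of `z` (for `z e = 1`). -/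
def projAlong (z : E →ₗ[ℝ] ℝ) (e : E) : E →ₗ[ℝ] E :=
  LinearMap.id - z.smulRight e

/-- Heights on the fibre points: a large multiple `M` of the given heights `ω` of the base point,
plus the convex function of the fibre coordinate whose increments over `a` are `d a 0 < d a 1 < ⋯`.
The fibre coordinate `z y` is a natural number at the points that matter, so that rounding it down
does not change it. -/
noncomputable def fibreHeight (z : E →ₗ[ℝ] ℝ) (e : E) (d : E → ℕ → ℕ) (M : ℝ) (ω : E → ℝ)
    (y : E) : ℝ :=
  M * ω (projAlong z e y) + ∑ i ∈ Finset.range ⌊z y⌋₊, (d (projAlong z e y) i : ℝ)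

/-- The functional that extends `M • u + r` with slope `s` in the direction of the fibres. -/
noncomputable def fibreSlope (z : E →ₗ[ℝ] ℝ) (e : E) (M : ℝ) (u r : E →ₗ[ℝ] ℝ) (s : ℕ) :
    E →ₗ[ℝ] ℝ :=
  (M • u + r) ∘ₗ projAlong z e + (s : ℝ) • z

variable {A : Finset E} {h : E → ℕ} {z : E →ₗ[ℝ] ℝ} {e : E} {d : E → ℕ → ℕ} {ω : E → ℝ}
  {M : ℝ} {u r : E →ₗ[ℝ] ℝ} {s : ℕ}

theorem mem_fibrePoints {y : E} :
    y ∈ fibrePoints A h e ↔ ∃ a ∈ A, ∃ j ≤ h a, y = a + (j : ℝ) • e := by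
  simp [fibrePoints, eq_comm]

theorem fibreHeight_sub_fibreSlope (hze : z e = 1) {a : E} (ha : z a = 0) (j : ℕ) :
    fibreHeight z e d M ω (a + (j : ℝ) • e) - fibreSlope z e M u r s (a + (j : ℝ) • e) =
      M * (ω a - u a) + tiltedSum (d a) s j - r a := by
  have hz : z (a + (j : ℝ) • e) = j := by simp [ha, hze]
  have hp : projAlong z e (a + (j : ℝ) • e) = a := by
    simp only [projAlong, LinearMap.sub_apply, LinearMap.id_apply, LinearMap.smulRight_apply, hz,
      add_sub_cancel_right]
  simp only [fibreHeight, fibreSlope, LinearMap.add_apply, LinearMap.comp_apply,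
    LinearMap.smul_apply, smul_eq_mul, hp, hz, Nat.floor_natCast, tiltedSum,
    Finset.sum_sub_distrib, Finset.sum_const, Finset.card_range, nsmul_eq_mul]
  ring

/-- If `r` takes on the vertices of the cell of `u` the minimal values of the tilted fibre
functions, and `M` is large enough to keep away the fibres over all other points, then the extended
functional cuts out the part of the staircase over the cell of `u` at the slope `s`. -/
theorem mem_lowerCell_fibre (hze : z e = 1) (hzA : ∀ a ∈ A, z a = 0) (hA : A.Nonempty)
    (hd : ∀ a ∈ A, StrictMono (d a))
    (hr : ∀ v ∈ lowerCell A ω u, r v = tiltedSum (d v) s (levelAt (d v) (h v) s))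
    (hM : ∀ a ∈ A, a ∉ lowerCell A ω u → ∀ j ≤ h a, ∀ v ∈ lowerCell A ω u,
      r a - tiltedSum (d a) s j < M * ((ω a - u a) - (ω v - u v))) {y : E} :
    y ∈ lowerCell (fibrePoints A h e) (fibreHeight z e d M ω) (fibreSlope z e M u r s) ↔
      ∃ v ∈ lowerCell A ω u, ∃ j : ℕ, levelAt (d v) (h v) s ≤ j ∧
        j ≤ levelAt (d v) (h v) (s + 1) ∧ y = v + (j : ℝ) • e := by
  obtain ⟨c, hc⟩ := lowerCell_nonempty (ω := ω) hA u
  have hcc := mem_lowerCell.1 hc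
  have hconst : ∀ v ∈ lowerCell A ω u, ω v - u v = ω c - u c := fun v hv =>
    le_antisymm ((mem_lowerCell.1 hv).2 c hcc.1) (hcc.2 v (lowerCell_subset hv))
  have hlow : ∀ a ∈ A, ∀ j ≤ h a, M * (ω c - u c) ≤
      M * (ω a - u a) + tiltedSum (d a) s j - r a := by
    intro a ha j hj
    by_cases hau : a ∈ lowerCell A ω u
    · rw [hconst a hau, hr a hau]
      linarith [tiltedSum_levelAt_le (s := s) (hd a ha) hj]
    · have := hM a ha hau j hj c hc
      rw [mul_sub] at this
      linarith
  rw [mem_lowerCell]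
  constructor
  · rintro ⟨hy, hmin⟩
    obtain ⟨a, ha, j, hj, rfl⟩ := mem_fibrePoints.1 hy
    have hcA := hcc.1
    have hmin' := hmin (c + (levelAt (d c) (h c) s : ℝ) • e)
      (mem_fibrePoints.2 ⟨c, hcA, _, levelAt_le, rfl⟩)
    rw [fibreHeight_sub_fibreSlope hze (hzA a ha), fibreHeight_sub_fibreSlope hze (hzA c hcA),
      hr c hc, add_sub_cancel_right] at hmin'
    have hau : a ∈ lowerCell A ω u := by
      by_contra hau
      have := hM a ha hau j hj c hc
      rw [mul_sub] at this
      linarith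
    rw [hconst a hau, hr a hau] at hmin'
    obtain ⟨h1, h2⟩ := (tiltedSum_le_iff (hd a ha) hj).1
      (by linarith : tiltedSum (d a) s j ≤ tiltedSum (d a) s (levelAt (d a) (h a) s))
    exact ⟨a, hau, j, h1, h2, rfl⟩
  · rintro ⟨v, hv, j, h1, h2, rfl⟩
    have hvA := lowerCell_subset hv
    have hj := h2.trans levelAt_le
    refine ⟨mem_fibrePoints.2 ⟨v, hvA, j, hj, rfl⟩, fun b hb => ?_⟩
    obtain ⟨a, ha, i, hi, rfl⟩ := mem_fibrePoints.1 hb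
    rw [fibreHeight_sub_fibreSlope hze (hzA a ha), fibreHeight_sub_fibreSlope hze (hzA v hvA)]
    refine le_trans ?_ (hlow a ha i hi)
    rw [hconst v hv, hr v hv]
    linarith [(tiltedSum_le_iff (hd v hvA) hj).2 ⟨h1, h2⟩]

end Fibre

/-! ### Cells of the fibre points -/

/-- A finite set of at most `n` vectors that generates the subgroup `Λ`. If `Λ` is a lattice of
rank `n`, this says that `σ` is a `ℤ`-basis of `Λ`. -/
def IsGeneratingCell {E : Type*} [AddCommGroup E] (n : ℕ) (Λ : Submodule ℤ E) (σ : Finset E) :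
    Prop :=
  σ.card ≤ n ∧ Submodule.span ℤ (σ : Set E) = Λ

/-- Convex functions on the fibres whose increments are all different. -/
theorem exists_strictMono_increments {E : Type*} (A : Finset E) :
    ∃ d : E → ℕ → ℕ, (∀ a, StrictMono (d a)) ∧
      ∀ a ∈ A, ∀ b ∈ A, ∀ i j, d a i = d b j → a = b := by
  obtain ⟨f, hf⟩ := Set.countable_iff_exists_injOn.1 A.countable_toSet
  refine ⟨fun a i => Nat.pair i (f a), fun a i j hij => Nat.pair_lt_pair_left _ hij, ?_⟩
  intro a ha b hb i j hab
  exact hf ha hb (Nat.pair_eq_pair.1 hab).2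

section FibreCover

variable {E : Type*} [AddCommGroup E] [Module ℝ E]

theorem LinearIndepOn.exists_linearMap_eq {σ : Set E} (hσ : LinearIndepOn ℝ id σ) (f : E → ℝ) :
    ∃ r : E →ₗ[ℝ] ℝ, ∀ v ∈ σ, r v = f v := by
  refine ⟨(Module.Basis.extend hσ).constr ℝ fun v => f v, fun v hv => ?_⟩
  have := (Module.Basis.extend hσ).constr_basis ℝ (fun v => f v)
    ⟨v, hσ.subset_extend (Set.subset_univ _) hv⟩
  rwa [Module.Basis.extend_apply_self] at this

theorem Convex.setOf_add_smul_mem {C : Set E} (hC : Convex ℝ C) (x e : E) :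
    Convex ℝ {t : ℝ | x + t • e ∈ C} := by
  intro a ha b hb p q hp hq hpq
  have hmem := hC ha hb hp hq hpq
  obtain rfl : q = 1 - p := by linarith
  rw [Set.mem_ofPred_eq]
  refine Set.mem_of_eq_of_mem ?_ hmem
  rw [smul_eq_mul, smul_eq_mul]
  module

variable {A : Finset E} {h : E → ℕ} {e : E} {d : E → ℕ → ℕ}

/-- One step of the staircase over a basis: exactly one fibre contributes two points, whose
difference is `e`. -/
theorem IsGeneratingCell.staircase {n : ℕ} {Λ : Submodule ℤ E} {σ τ : Finset E}
    (hσ : IsGeneratingCell n Λ σ) (hd : ∀ v ∈ σ, StrictMono (d v))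
    (hinj : ∀ a ∈ σ, ∀ b ∈ σ, ∀ i j, d a i = d b j → a = b) {v₀ : E} (hv₀ : v₀ ∈ σ) {j₀ : ℕ}
    (hj₀ : j₀ < h v₀)
    (hτ : ∀ y, y ∈ τ ↔ ∃ v ∈ σ, ∃ j : ℕ, levelAt (d v) (h v) (d v₀ j₀) ≤ j ∧
        j ≤ levelAt (d v) (h v) (d v₀ j₀ + 1) ∧ y = v + (j : ℝ) • e) :
    IsGeneratingCell (n + 1) (Λ ⊔ Submodule.span ℤ {e}) τ := by
  classical
  have hsmul : ∀ j : ℕ, (j : ℝ) • e = (j : ℤ) • e := fun j => by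
    rw [natCast_zsmul, Nat.cast_smul_eq_nsmul]
  constructor
  · have hsub : τ ⊆ insert (v₀ + ((j₀ + 1 : ℕ) : ℝ) • e)
        (σ.image fun v => v + (levelAt (d v) (h v) (d v₀ j₀) : ℝ) • e) := by
      intro y hy
      obtain ⟨v, hv, j, h1, h2, rfl⟩ := (hτ y).1 hy
      rw [Finset.mem_insert, Finset.mem_image]
      by_cases hvv : v = v₀
      · subst hvv
        rw [levelAt_apply (hd v hv) hj₀] at h1
        rw [levelAt_apply_succ (hd v hv) hj₀] at h2
        rcases h2.eq_or_lt with rfl | h2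
        · exact Or.inl rfl
        · refine Or.inr ⟨v, hv, ?_⟩
          rw [levelAt_apply (hd v hv) hj₀, le_antisymm h1 (Nat.lt_succ_iff.1 h2)]
      · rw [levelAt_succ_of_forall_ne (hd v hv) fun i _ hi => hvv (hinj v hv v₀ hv₀ i j₀ hi)] at h2
        exact Or.inr ⟨v, hv, by rw [le_antisymm h1 h2]⟩
    calc τ.card ≤ _ := Finset.card_le_card hsub
      _ ≤ _ := Finset.card_insert_le _ _
      _ ≤ n + 1 := Nat.succ_le_succ (Finset.card_image_le.trans hσ.1)
  · have he : e ∈ Submodule.span ℤ (τ : Set E) := by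
      have h1 : v₀ + (j₀ : ℝ) • e ∈ τ := (hτ _).2 ⟨v₀, hv₀, j₀,
        (levelAt_apply (hd v₀ hv₀) hj₀).le,
        (Nat.le_succ _).trans (levelAt_apply_succ (hd v₀ hv₀) hj₀).ge, rfl⟩
      have h2 : v₀ + ((j₀ + 1 : ℕ) : ℝ) • e ∈ τ := (hτ _).2 ⟨v₀, hv₀, j₀ + 1,
        (levelAt_apply (hd v₀ hv₀) hj₀).le.trans (Nat.le_succ _),
        (levelAt_apply_succ (hd v₀ hv₀) hj₀).ge, rfl⟩
      have h3 := Submodule.sub_mem _ (Submodule.subset_span (R := ℤ) (Finset.mem_coe.2 h2))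
        (Submodule.subset_span (Finset.mem_coe.2 h1))
      have h4 : v₀ + ((j₀ + 1 : ℕ) : ℝ) • e - (v₀ + (j₀ : ℝ) • e) = e := by
        push_cast
        module
      rwa [h4] at h3
    refine le_antisymm (Submodule.span_le.2 fun y hy => ?_) (sup_le ?_ ?_)
    · obtain ⟨v, hv, j, -, -, rfl⟩ := (hτ y).1 hy
      rw [hsmul]
      exact Submodule.add_mem_sup (hσ.2 ▸ Submodule.subset_span hv)
        (Submodule.smul_mem _ _ (Submodule.mem_span_singleton_self e))
    · rw [← hσ.2, Submodule.span_le]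
      intro v hv
      have h1 : v + (levelAt (d v) (h v) (d v₀ j₀) : ℝ) • e ∈ τ :=
        (hτ _).2 ⟨v, hv, _, le_rfl, levelAt_le_succ (hd v hv), rfl⟩
      have h3 := Submodule.sub_mem _ (Submodule.subset_span (R := ℤ) (Finset.mem_coe.2 h1))
        (Submodule.smul_mem _ (levelAt (d v) (h v) (d v₀ j₀) : ℤ) he)
      rwa [hsmul, add_sub_cancel_right] at h3
    · rwa [Submodule.span_singleton_le_iff_mem]

/-- The pieces of the staircases over a simplex `σ` cover the part between `0` and the interpolated
height `h` of the fibres over `σ`. -/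
theorem add_smul_mem_convexHull_staircase {σ : Finset E} {τ : Set E} {w : E → ℝ} {s : ℕ} {t : ℝ}
    (hw : ∀ v ∈ σ, 0 ≤ w v) (hw1 : ∑ v ∈ σ, w v = 1) (hd : ∀ v ∈ σ, StrictMono (d v))
    (hτ : ∀ v ∈ σ, ∀ j : ℕ, levelAt (d v) (h v) s ≤ j → j ≤ levelAt (d v) (h v) (s + 1) →
      v + (j : ℝ) • e ∈ τ)
    (ht : ∑ v ∈ σ, w v * levelAt (d v) (h v) s ≤ t)
    (ht' : t ≤ ∑ v ∈ σ, w v * levelAt (d v) (h v) (s + 1)) :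
    ∑ v ∈ σ, w v • v + t • e ∈ convexHull ℝ τ := by
  have hpt : ∀ k : E → ℕ, (∀ v ∈ σ, levelAt (d v) (h v) s ≤ k v ∧
      k v ≤ levelAt (d v) (h v) (s + 1)) →
      ∑ v ∈ σ, w v • v + (∑ v ∈ σ, w v * k v) • e ∈ convexHull ℝ τ := by
    intro k hk
    have heq : ∑ v ∈ σ, w v • v + (∑ v ∈ σ, w v * k v) • e =
        ∑ v ∈ σ, w v • (v + (k v : ℝ) • e) := by
      simp only [smul_add, Finset.sum_add_distrib, Finset.sum_smul, mul_smul]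
    rw [heq]
    exact (convex_convexHull ℝ τ).sum_mem hw hw1 fun v hv =>
      subset_convexHull ℝ _ (hτ v hv _ (hk v hv).1 (hk v hv).2)
  have h1 := hpt (fun v => levelAt (d v) (h v) s) fun v hv => ⟨le_rfl, levelAt_le_succ (hd v hv)⟩
  have h2 := hpt (fun v => levelAt (d v) (h v) (s + 1)) fun v hv =>
    ⟨levelAt_le_succ (hd v hv), le_rfl⟩
  exact ((convex_convexHull ℝ τ).setOf_add_smul_mem _ e).ordConnected.out h1 h2 ⟨ht, ht'⟩

/-- The induction step: if the cells of finitely many functionals, all of them bases of `Λ`, cover a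
set, then finitely many cells of the fibre points, all of them generating `Λ ⊔ ℤ e` by as few
vectors as possible, cover the part of the fibres over this set up to the height `g`. -/
theorem exists_fibre_cover {z : E →ₗ[ℝ] ℝ} (hze : z e = 1) (hzA : ∀ a ∈ A, z a = 0)
    (hA : A.Nonempty) {ω : E → ℝ} {n : ℕ} {Λ : Submodule ℤ E} {U : Finset (E →ₗ[ℝ] ℝ)}
    (hU : ∀ u ∈ U, IsGeneratingCell n Λ (lowerCell A ω u))
    (hind : ∀ u ∈ U, LinearIndepOn ℝ id (lowerCell A ω u : Set E))
    (hpos : ∀ u ∈ U, ∃ v ∈ lowerCell A ω u, 0 < h v)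
    {g : E →ₗ[ℝ] ℝ} (hg : ∀ a ∈ A, g a = h a) :
    ∃ (ω' : E → ℝ) (U' : Finset (E →ₗ[ℝ] ℝ)),
      (∀ u ∈ U', IsGeneratingCell (n + 1) (Λ ⊔ Submodule.span ℤ {e})
        (lowerCell (fibrePoints A h e) ω' u)) ∧
      ∀ u ∈ U, ∀ x ∈ convexHull ℝ (lowerCell A ω u : Set E), ∀ t : ℝ, 0 ≤ t → t ≤ g x →
        ∃ u' ∈ U', x + t • e ∈ convexHull ℝ (lowerCell (fibrePoints A h e) ω' u' : Set E) := by
  classical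
  obtain ⟨d, hd, hinj⟩ := exists_strictMono_increments A
  have hr : ∀ (u : E →ₗ[ℝ] ℝ) (s : ℕ), ∃ r : E →ₗ[ℝ] ℝ, u ∈ U →
      ∀ v ∈ lowerCell A ω u, r v = tiltedSum (d v) s (levelAt (d v) (h v) s) := by
    intro u s
    by_cases hu : u ∈ U
    · obtain ⟨r, hr⟩ := (hind u hu).exists_linearMap_eq
        fun v => tiltedSum (d v) s (levelAt (d v) (h v) s)
      exact ⟨r, fun _ => hr⟩
    · exact ⟨0, fun h' => absurd h' hu⟩
  choose r hr using hr
  let S : (E →ₗ[ℝ] ℝ) → Finset ℕ := fun u =>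
    (lowerCell A ω u).biUnion fun v => (Finset.range (h v)).image (d v)
  have hS : ∀ u s, s ∈ S u ↔ ∃ v ∈ lowerCell A ω u, ∃ j < h v, d v j = s := by
    simp [S]
  have hM : ∀ᶠ M : ℝ in Filter.atTop, ∀ u ∈ U, ∀ s ∈ S u, ∀ a ∈ A, ∀ j ∈ Finset.range (h a + 1),
      ∀ v ∈ lowerCell A ω u, a ∉ lowerCell A ω u →
      r u s a - tiltedSum (d a) s j < M * ((ω a - u a) - (ω v - u v)) := by
    simp only [Filter.eventually_all_finset]
    intro u hu s hs a ha j hj v hv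
    by_cases hau : a ∈ lowerCell A ω u
    · simp [hau]
    · have hlt : 0 < (ω a - u a) - (ω v - u v) := by
        by_contra hcon
        exact hau (mem_lowerCell.2 ⟨ha, fun b hb => by linarith [(mem_lowerCell.1 hv).2 b hb]⟩)
      filter_upwards [(Filter.tendsto_id.atTop_mul_const hlt).eventually_gt_atTop
        (r u s a - tiltedSum (d a) s j)] with M hM _ using hM
  obtain ⟨M, hM⟩ := hM.exists
  have hcell : ∀ u ∈ U, ∀ s ∈ S u, ∀ y, y ∈ lowerCell (fibrePoints A h e) (fibreHeight z e d M ω)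
      (fibreSlope z e M u (r u s) s) ↔ ∃ v ∈ lowerCell A ω u, ∃ j : ℕ,
        levelAt (d v) (h v) s ≤ j ∧ j ≤ levelAt (d v) (h v) (s + 1) ∧ y = v + (j : ℝ) • e :=
    fun u hu s hs y => mem_lowerCell_fibre hze hzA hA (fun a _ => hd a) (hr u s hu)
      fun a ha hau j hj v hv =>
        hM u hu s hs a ha j (Finset.mem_range.2 (Nat.lt_succ_iff.2 hj)) v hv hau
  refine ⟨fibreHeight z e d M ω,
    U.biUnion fun u => (S u).image fun s => fibreSlope z e M u (r u s) s, ?_, ?_⟩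
  · intro u' hu'
    obtain ⟨u, hu, hu'⟩ := Finset.mem_biUnion.1 hu'
    obtain ⟨s, hs, rfl⟩ := Finset.mem_image.1 hu'
    obtain ⟨v₀, hv₀, j₀, hj₀, rfl⟩ := (hS u s).1 hs
    exact (hU u hu).staircase (fun v _ => hd v)
      (fun a ha b hb => hinj a (lowerCell_subset ha) b (lowerCell_subset hb)) hv₀ hj₀
      (hcell u hu _ hs)
  · intro u hu x hx t ht0 ht
    obtain ⟨w, hw, hw1, rfl⟩ := Finset.mem_convexHull'.1 hx
    have htw : t ≤ ∑ v ∈ lowerCell A ω u, w v * h v := by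
      refine ht.trans_eq ?_
      rw [map_sum]
      exact Finset.sum_congr rfl fun v hv => by
        rw [map_smul, smul_eq_mul, hg v (lowerCell_subset hv)]
    obtain ⟨v₀, hv₀, j₀, hj₀, h1, h2⟩ := exists_slope (fun v _ => hd v) (hpos u hu) ht0 htw
    have hs : d v₀ j₀ ∈ S u := (hS u _).2 ⟨v₀, hv₀, j₀, hj₀, rfl⟩
    refine ⟨_, Finset.mem_biUnion.2 ⟨u, hu, Finset.mem_image_of_mem _ hs⟩, ?_⟩
    exact add_smul_mem_convexHull_staircase hw hw1 (fun v _ => hd v)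
      (fun v hv j hj1 hj2 => Finset.mem_coe.2 ((hcell u hu _ hs _).2 ⟨v, hv, j, hj1, hj2, rfl⟩))
      h1 h2

end FibreCover

/-! ### The polytopes attached to admissible sequences -/

section CoordLattice

/-- The lattice `ℤ^n × 0` in `ℝ^d`. -/
def coordLattice (d n : ℕ) : Submodule ℤ (Fin d → ℝ) :=
  Submodule.span ℤ ((fun j => Pi.single j (1 : ℝ)) '' {j : Fin d | (j : ℕ) < n})

variable {d n : ℕ}

theorem single_mem_coordLattice {j : Fin d} (hj : (j : ℕ) < n) :
    Pi.single j (1 : ℝ) ∈ coordLattice d n :=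
  Submodule.subset_span ⟨j, hj, rfl⟩

theorem mem_coordLattice {x : Fin d → ℝ} :
    x ∈ coordLattice d n ↔ (∀ j, ∃ k : ℤ, x j = k) ∧ ∀ j : Fin d, n ≤ (j : ℕ) → x j = 0 := by
  constructor
  · intro hx
    induction hx using Submodule.span_induction with
    | mem x hx =>
      obtain ⟨i, hi, rfl⟩ := hx
      refine ⟨fun j => ?_, fun j hj => ?_⟩
      · by_cases hij : j = i
        · exact ⟨1, by simp [hij]⟩
        · exact ⟨0, by simp [hij]⟩
      · have hij : j ≠ i := by
          rintro rfl
          exact absurd hi (not_lt.2 hj)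
        simp [hij]
    | zero => exact ⟨fun j => ⟨0, by simp⟩, fun j _ => rfl⟩
    | add x y _ _ hx hy =>
      refine ⟨fun j => ?_, fun j hj => by simp [hx.2 j hj, hy.2 j hj]⟩
      obtain ⟨k, hk⟩ := hx.1 j
      obtain ⟨l, hl⟩ := hy.1 j
      exact ⟨k + l, by simp [hk, hl]⟩
    | smul c x _ hx =>
      refine ⟨fun j => ?_, fun j hj => by simp [hx.2 j hj]⟩
      obtain ⟨k, hk⟩ := hx.1 j
      exact ⟨c * k, by simp [hk]⟩
  · rintro ⟨hx, hx0⟩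
    choose k hk using hx
    have : x = ∑ j, k j • Pi.single j (1 : ℝ) := by
      ext i
      simp [hk, Pi.single_apply]
    rw [this]
    refine Submodule.sum_mem _ fun j _ => ?_
    by_cases hj : (j : ℕ) < n
    · exact Submodule.smul_mem _ _ (single_mem_coordLattice hj)
    · have h0 := hx0 j (not_lt.1 hj)
      rw [hk, Int.cast_eq_zero] at h0
      rw [h0, zero_smul]
      exact Submodule.zero_mem _

theorem stdLattice_eq_coordLattice : stdLattice d = coordLattice d d := by
  rw [stdLattice, coordLattice]
  congr 1
  ext x
  simp

theorem coordLattice_one (hd : 0 < d) :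
    coordLattice d 1 = Submodule.span ℤ {Pi.single ⟨0, hd⟩ (1 : ℝ)} := by
  have h : {j : Fin d | (j : ℕ) < 1} = {⟨0, hd⟩} := by
    ext j
    simp [Fin.ext_iff]
  rw [coordLattice, h, Set.image_singleton]

theorem coordLattice_succ (hn : n < d) :
    coordLattice d (n + 1) =
      coordLattice d n ⊔ Submodule.span ℤ {Pi.single ⟨n, hn⟩ (1 : ℝ)} := by
  have h : {j : Fin d | (j : ℕ) < n + 1} = {j : Fin d | (j : ℕ) < n} ∪ {⟨n, hn⟩} := by
    ext j
    simp only [Set.mem_ofPred_eq, Set.mem_union, Set.mem_singleton_iff, Fin.ext_iff]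
    omega
  rw [coordLattice, coordLattice, h, Set.image_union, Set.image_singleton, Submodule.span_union]

theorem finrank_span_coordLattice (hn : n ≤ d) :
    Module.finrank ℝ (Submodule.span ℝ (coordLattice d n : Set (Fin d → ℝ))) = n := by
  have h1 : Submodule.span ℝ (coordLattice d n : Set (Fin d → ℝ)) =
      Submodule.span ℝ (Set.range fun i : Fin n => Pi.basisFun ℝ (Fin d) (Fin.castLE hn i)) := by
    rw [coordLattice, Submodule.span_span_of_tower]
    congr 1
    ext x
    constructor
    · rintro ⟨j, hj, rfl⟩
      exact ⟨⟨j, hj⟩, by simp⟩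
    · rintro ⟨i, rfl⟩
      exact ⟨Fin.castLE hn i, i.2, by simp⟩
  rw [h1, finrank_span_eq_card, Fintype.card_fin]
  exact (Pi.basisFun ℝ (Fin d)).linearIndependent.comp _ (Fin.castLE_injective hn)

variable {σ : Finset (Fin d → ℝ)}

theorem IsGeneratingCell.span_real (hσ : IsGeneratingCell n (coordLattice d n) σ) :
    Submodule.span ℝ (σ : Set (Fin d → ℝ)) =
      Submodule.span ℝ (coordLattice d n : Set (Fin d → ℝ)) := by
  rw [← hσ.2, Submodule.span_span_of_tower]

theorem IsGeneratingCell.linearIndependent (hn : n ≤ d)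
    (hσ : IsGeneratingCell n (coordLattice d n) σ) :
    LinearIndependent ℝ ((↑) : σ → Fin d → ℝ) := by
  rw [linearIndependent_iff_card_le_finrank_span, Set.finrank, Fintype.card_coe,
    Subtype.range_coe_subtype]
  change σ.card ≤ Module.finrank ℝ (Submodule.span ℝ (σ : Set (Fin d → ℝ)))
  rw [hσ.span_real, finrank_span_coordLattice hn]
  exact hσ.1

end CoordLattice

section Model

variable {d : ℕ}

/-- The pairing with an integral row vector as a linear map. -/
noncomputable def rowPairingLinear (m : Fin d → ℤ) : (Fin d → ℝ) →ₗ[ℝ] ℝ :=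
  ∑ j, (m j : ℝ) • LinearMap.proj j

theorem rowPairingLinear_apply (m : Fin d → ℤ) (x : Fin d → ℝ) :
    rowPairingLinear m x = rowPairing m x := by
  simp [rowPairingLinear, rowPairing]

theorem convex_nakajimaModel : ∀ (ℓ : ℕ) (m : Fin ℓ → Fin d → ℤ), Convex ℝ (nakajimaModel ℓ m)
  | 0, _ => convex_singleton _
  | _ + 1, _ => convex_convexHull ℝ _

theorem nakajimaModel_zero (m : Fin 0 → Fin d → ℤ) (hd : 0 < d) :
    nakajimaModel 0 m = {Pi.single ⟨0, hd⟩ (1 : ℝ)} := by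
  rw [nakajimaModel]
  congr 1
  ext j
  simp [Pi.single_apply, Fin.ext_iff]

theorem nakajimaModel_coord {ℓ : ℕ} (m : Fin ℓ → Fin d → ℤ) {x : Fin d → ℝ}
    (hx : x ∈ nakajimaModel ℓ m) :
    (∀ j : Fin d, (j : ℕ) = 0 → x j = 1) ∧ ∀ j : Fin d, ℓ < (j : ℕ) → x j = 0 := by
  induction ℓ generalizing x with
  | zero =>
    rw [nakajimaModel, Set.mem_singleton_iff] at hx
    subst hx
    exact ⟨fun j hj => if_pos hj, fun j hj => if_neg hj.ne'⟩
  | succ ℓ ih =>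
    have hconv : Convex ℝ {x : Fin d → ℝ | (∀ j : Fin d, (j : ℕ) = 0 → x j = 1) ∧
        ∀ j : Fin d, ℓ + 1 < (j : ℕ) → x j = 0} := by
      intro y hy y' hy' a b _ _ hab
      refine ⟨fun j hj => ?_, fun j hj => ?_⟩
      · simp [hy.1 j hj, hy'.1 j hj, hab]
      · simp [hy.2 j hj, hy'.2 j hj]
    refine convexHull_min (Set.union_subset ?_ ?_) hconv hx
    · intro y hy
      obtain ⟨h1, h2⟩ := ih _ hy
      exact ⟨h1, fun j hj => h2 j (by omega)⟩
    · rintro _ ⟨y, hy, rfl⟩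
      obtain ⟨h1, h2⟩ := ih _ hy
      refine ⟨fun j hj => ?_, fun j hj => ?_⟩
      · simp [hj, h1 j hj]
      · simp [hj.ne', h2 j (by omega)]

/-- The model polytope of `ℓ + 1` rows consists of the points of the fibres over the previous one
between the heights `0` and the pairing with the last row. -/
theorem mem_nakajimaModel_succ {ℓ : ℕ} {m : Fin (ℓ + 1) → Fin d → ℤ} (hℓ : ℓ + 1 < d)
    (hm : IsAdmissible (ℓ + 1) m) {y : Fin d → ℝ} :
    y ∈ nakajimaModel (ℓ + 1) m ↔ ∃ x ∈ nakajimaModel ℓ (fun k => m k.castSucc), ∃ t : ℝ,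
      0 ≤ t ∧ t ≤ rowPairingLinear (m (Fin.last ℓ)) x ∧
        y = x + t • Pi.single ⟨ℓ + 1, hℓ⟩ (1 : ℝ) := by
  have htop : ∀ x ∈ nakajimaModel ℓ (fun k => m k.castSucc),
      (fun j : Fin d => if (j : ℕ) = ℓ + 1 then rowPairing (m (Fin.last ℓ)) x else x j) =
        x + rowPairingLinear (m (Fin.last ℓ)) x • Pi.single ⟨ℓ + 1, hℓ⟩ (1 : ℝ) := by
    intro x hx
    ext j
    by_cases hj : (j : ℕ) = ℓ + 1
    · have hj' : j = ⟨ℓ + 1, hℓ⟩ := Fin.ext hj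
      subst hj'
      simp [rowPairingLinear_apply, (nakajimaModel_coord _ hx).2 ⟨ℓ + 1, hℓ⟩ (Nat.lt_succ_self ℓ)]
    · have hj' : j ≠ ⟨ℓ + 1, hℓ⟩ := fun h => hj (congrArg Fin.val h)
      simp [hj, hj']
  constructor
  · intro hy
    refine convexHull_min (t := {y | ∃ x ∈ nakajimaModel ℓ (fun k => m k.castSucc), ∃ t : ℝ,
      0 ≤ t ∧ t ≤ rowPairingLinear (m (Fin.last ℓ)) x ∧
        y = x + t • Pi.single ⟨ℓ + 1, hℓ⟩ (1 : ℝ)}) (Set.union_subset ?_ ?_) ?_ hy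
    · intro x hx
      exact ⟨x, hx, 0, le_rfl, (hm.2.2.2 x hx).trans_eq (rowPairingLinear_apply _ _).symm, by simp⟩
    · rintro _ ⟨x, hx, rfl⟩
      exact ⟨x, hx, _, (hm.2.2.2 x hx).trans_eq (rowPairingLinear_apply _ _).symm, le_rfl,
        htop x hx⟩
    · rintro _ ⟨x, hx, t, ht0, ht, rfl⟩ _ ⟨x', hx', t', ht0', ht', rfl⟩ a b ha hb hab
      refine ⟨a • x + b • x', convex_nakajimaModel _ _ hx hx' ha hb hab, a * t + b * t',
        by positivity, ?_, by module⟩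
      rw [map_add, map_smul, map_smul, smul_eq_mul, smul_eq_mul]
      exact add_le_add (mul_le_mul_of_nonneg_left ht ha) (mul_le_mul_of_nonneg_left ht' hb)
  · rintro ⟨x, hx, t, ht0, ht, rfl⟩
    have h0 : x + (0 : ℝ) • Pi.single ⟨ℓ + 1, hℓ⟩ (1 : ℝ) ∈ nakajimaModel (ℓ + 1) m := by
      rw [zero_smul, add_zero]
      exact subset_convexHull ℝ _ (Or.inl hx)
    have h1 : x + rowPairingLinear (m (Fin.last ℓ)) x • Pi.single ⟨ℓ + 1, hℓ⟩ (1 : ℝ) ∈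
        nakajimaModel (ℓ + 1) m :=
      subset_convexHull ℝ _ (Or.inr ⟨x, hx, htop x hx⟩)
    exact ((convex_nakajimaModel (ℓ + 1) m).setOf_add_smul_mem x _).ordConnected.out h0 h1 ⟨ht0, ht⟩

/-- Every model polytope has a configuration of lattice points and heights whose cells that are
bases of `ℤ^{ℓ+1} × 0` cover it. Finitely many functionals suffice, which is what allows a uniform
choice of the multiple `M` in the induction. -/
theorem exists_nakajimaModel_cover {ℓ : ℕ} (m : Fin ℓ → Fin d → ℤ) (hℓ : ℓ < d)
    (hm : IsAdmissible ℓ m) :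
    ∃ (A : Finset (Fin d → ℝ)) (ω : (Fin d → ℝ) → ℝ) (U : Finset ((Fin d → ℝ) →ₗ[ℝ] ℝ)),
      A.Nonempty ∧ (A : Set (Fin d → ℝ)) ⊆ nakajimaModel ℓ m ∧
      (∀ a ∈ A, a ∈ coordLattice d (ℓ + 1)) ∧
      (∀ u ∈ U, IsGeneratingCell (ℓ + 1) (coordLattice d (ℓ + 1)) (lowerCell A ω u)) ∧
      ∀ x ∈ nakajimaModel ℓ m, ∃ u ∈ U, x ∈ convexHull ℝ (lowerCell A ω u : Set (Fin d → ℝ)) := by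
  induction ℓ with
  | zero =>
    have hcell : lowerCell {Pi.single ⟨0, hℓ⟩ (1 : ℝ)} 0 (0 : (Fin d → ℝ) →ₗ[ℝ] ℝ) =
        {Pi.single ⟨0, hℓ⟩ (1 : ℝ)} := by
      ext x
      simp [mem_lowerCell]
    refine ⟨{Pi.single ⟨0, hℓ⟩ (1 : ℝ)}, 0, {0}, Finset.singleton_nonempty _, ?_, ?_, ?_, ?_⟩
    · rw [nakajimaModel_zero m hℓ, Finset.coe_singleton]
    · intro a ha
      rw [Finset.mem_singleton.1 ha]
      exact single_mem_coordLattice (Nat.zero_lt_one)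
    · intro u hu
      rw [Finset.mem_singleton.1 hu, hcell]
      refine ⟨by simp, ?_⟩
      rw [Finset.coe_singleton, coordLattice_one hℓ]
    · intro x hx
      refine ⟨0, Finset.mem_singleton_self _, ?_⟩
      rw [hcell, Finset.coe_singleton, convexHull_singleton, ← nakajimaModel_zero m hℓ]
      exact hx
  | succ ℓ ih =>
    obtain ⟨A, ω, U, hA, hAP, hAL, hU, hcov⟩ := ih (fun k => m k.castSucc) (by omega) hm.1
    set row := m (Fin.last ℓ) with hrow
    set g := rowPairingLinear row with hg
    set e : Fin d → ℝ := Pi.single ⟨ℓ + 1, hℓ⟩ 1 with he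
    let h : (Fin d → ℝ) → ℕ := fun a => ⌊g a⌋₊
    have hgh : ∀ a ∈ A, g a = h a := by
      intro a ha
      have h0 : 0 ≤ g a := (hm.2.2.2 a (hAP ha)).trans_eq (rowPairingLinear_apply _ _).symm
      have hint : ∃ k : ℤ, g a = k := by
        choose k hk using (mem_coordLattice.1 (hAL a ha)).1
        exact ⟨∑ j, row j * k j, by simp [hg, rowPairingLinear_apply, rowPairing, hk]⟩
      obtain ⟨k, hk⟩ := hint
      rw [hk] at h0
      lift k to ℕ using by exact_mod_cast h0
      simp [h, hk]
    have hpos : ∀ u ∈ U, ∃ v ∈ lowerCell A ω u, 0 < h v := by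
      intro u hu
      by_contra! hcon
      refine hm.2.1 (funext fun j => ?_)
      rcases lt_or_ge ℓ (j : ℕ) with hj | hj
      · exact hm.2.2.1 j hj
      · have hle : coordLattice d (ℓ + 1) ≤ LinearMap.ker (g.restrictScalars ℤ) := by
          rw [← (hU u hu).2, Submodule.span_le]
          intro v hv
          simp [hgh v (lowerCell_subset hv), Nat.le_zero.1 (hcon v hv)]
        have := hle (single_mem_coordLattice (Nat.lt_succ_of_le hj))
        simpa [hg, rowPairingLinear_apply, rowPairing, Pi.single_apply] using this
    obtain ⟨ω', U', hU', hcov'⟩ := exists_fibre_cover (z := LinearMap.proj ⟨ℓ + 1, hℓ⟩) (e := e)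
      (by simp [he]) (fun a ha => (mem_coordLattice.1 (hAL a ha)).2 _ le_rfl) hA hU
      (fun u hu => (hU u hu).linearIndependent hℓ.le) hpos hgh
    rw [← coordLattice_succ hℓ] at hU'
    refine ⟨fibrePoints A h e, ω', U', ?_, ?_, ?_, hU', ?_⟩
    · obtain ⟨a, ha⟩ := hA
      exact ⟨a, mem_fibrePoints.2 ⟨a, ha, 0, Nat.zero_le _, by simp⟩⟩
    · intro y hy
      obtain ⟨a, ha, j, hj, rfl⟩ := mem_fibrePoints.1 (Finset.mem_coe.1 hy)
      refine (mem_nakajimaModel_succ hℓ hm).2 ⟨a, hAP ha, j, Nat.cast_nonneg _, ?_, rfl⟩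
      rw [← hrow, ← hg, hgh a ha]
      exact_mod_cast hj
    · intro y hy
      obtain ⟨a, ha, j, hj, rfl⟩ := mem_fibrePoints.1 hy
      rw [coordLattice_succ hℓ, Nat.cast_smul_eq_nsmul]
      exact Submodule.add_mem_sup (hAL a ha)
        (Submodule.smul_of_tower_mem _ j (Submodule.mem_span_singleton_self _))
    · intro y hy
      obtain ⟨x, hx, t, ht0, ht, rfl⟩ := (mem_nakajimaModel_succ hℓ hm).1 hy
      obtain ⟨u, hu, hxu⟩ := hcov x hx
      exact hcov' u hu x hxu t ht0 ht

end Model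

/-! ### Transport along a lattice equivalence -/

section Transport

variable {V E : Type*} [AddCommGroup V] [Module ℝ V] [AddCommGroup E] [Module ℝ E]

/-- Pulling back heights and functionals along an affine map pulls back the cells: the constant part
of the affine map does not affect where the minimum is attained. -/
theorem mem_lowerCell_comp [DecidableEq E] (f : V →ᵃ[ℝ] E) {A : Finset V} {ω : E → ℝ}
    {u : E →ₗ[ℝ] ℝ} {v : V} :
    v ∈ lowerCell A (ω ∘ f) (u ∘ₗ f.linear) ↔ v ∈ A ∧ f v ∈ lowerCell (A.image f) ω u := by
  have hval : ∀ y, (ω ∘ f) y - (u ∘ₗ f.linear) y = ω (f y) - u (f y) + u (f 0) := by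
    intro y
    have : f y = f.linear y + f 0 := congrFun f.decomp y
    simp only [Function.comp_apply, LinearMap.comp_apply]
    conv_rhs => rw [this, map_add]
    rw [← this]
    ring
  rw [mem_lowerCell, mem_lowerCell, Finset.forall_mem_image]
  simp only [hval, add_le_add_iff_right]
  exact ⟨fun h => ⟨h.1, Finset.mem_image_of_mem f h.1, h.2⟩, fun h => ⟨h.1, h.2.2⟩⟩

theorem image_lowerCell_comp [DecidableEq E] (f : V →ᵃ[ℝ] E) (A : Finset V) (ω : E → ℝ)
    (u : E →ₗ[ℝ] ℝ) :
    (lowerCell A (ω ∘ f) (u ∘ₗ f.linear)).image f = lowerCell (A.image f) ω u := by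
  ext y
  rw [Finset.mem_image]
  constructor
  · rintro ⟨v, hv, rfl⟩
    exact ((mem_lowerCell_comp f).1 hv).2
  · intro hy
    obtain ⟨v, hv, rfl⟩ := Finset.mem_image.1 (lowerCell_subset hy)
    exact ⟨v, (mem_lowerCell_comp f).2 ⟨hv, hy⟩, rfl⟩

theorem sum_smul_mem_affineSpan {s : Finset V} {Q : Set V} (hs : (s : Set V) ⊆ Q) {w : V → ℝ}
    (hw : ∑ v ∈ s, w v = 1) : ∑ v ∈ s, w v • v ∈ affineSpan ℝ Q := by
  have := affineCombination_mem_affineSpan_image hw (s' := Q)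
    (fun i hi hi' => absurd (hs hi) hi') (id : V → V)
  rwa [Finset.affineCombination_eq_linear_combination _ _ _ hw, Set.image_id] at this

/-- An affine combination of the images of points of `P` under an affine map that is injective on
the affine hull of `P` pulls back to the same combination of the points. -/
theorem sum_smul_eq_of_map_eq [DecidableEq E] {f : V →ᵃ[ℝ] E} {P : Set V}
    (hf : Set.InjOn f (affineSpan ℝ P : Set V)) {s : Finset V} (hs : (s : Set V) ⊆ P) {w : E → ℝ}
    (hw : ∑ a ∈ s.image f, w a = 1) {y : V} (hy : y ∈ affineSpan ℝ P)
    (hfy : ∑ a ∈ s.image f, w a • a = f y) :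
    ∑ v ∈ s, w (f v) = 1 ∧ ∑ v ∈ s, w (f v) • v = y := by
  have hinj : Set.InjOn f s := hf.mono (hs.trans (subset_affineSpan ℝ P))
  rw [Finset.sum_image hinj] at hw hfy
  refine ⟨hw, hf (sum_smul_mem_affineSpan hs hw) hy ?_⟩
  rw [← hfy, ← Finset.affineCombination_eq_linear_combination s (fun v => v) _ hw,
    Finset.map_affineCombination s _ _ hw f,
    Finset.affineCombination_eq_linear_combination _ _ _ hw]
  rfl

end Transport

theorem mem_coordLattice_of_mem_affineSpan {d ℓ : ℕ} (hℓ : ℓ < d) {m : Fin ℓ → Fin d → ℤ}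
    {x : Fin d → ℝ} (hx : x ∈ affineSpan ℝ (nakajimaModel ℓ m)) (hxL : x ∈ stdLattice d) :
    x ∈ coordLattice d (ℓ + 1) ∧ x ⟨0, by omega⟩ = 1 := by
  have hcoord : x ⟨0, by omega⟩ = 1 ∧ ∀ j : Fin d, ℓ < (j : ℕ) → x j = 0 := by
    refine affineSpan_induction hx (fun y hy => ?_) fun c y y' y'' hy hy' hy'' => ?_
    · exact ⟨(nakajimaModel_coord m hy).1 _ rfl, (nakajimaModel_coord m hy).2⟩
    · refine ⟨by simp [hy.1, hy'.1, hy''.1], fun j hj => ?_⟩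
      simp [hy.2 j hj, hy'.2 j hj, hy''.2 j hj]
  rw [stdLattice_eq_coordLattice, mem_coordLattice] at hxL
  exact ⟨mem_coordLattice.2 ⟨hxL.1, hcoord.2⟩, hcoord.1⟩

/-- On the hyperplane where the first coordinate is `1`, integral linear combinations are integral
affine combinations. -/
theorem IsGeneratingCell.exists_sum_eq {d ℓ : ℕ} (hℓ : ℓ < d) {m : Fin ℓ → Fin d → ℤ}
    {σ : Finset (Fin d → ℝ)} (hσ : IsGeneratingCell (ℓ + 1) (coordLattice d (ℓ + 1)) σ)
    (hσP : (σ : Set (Fin d → ℝ)) ⊆ nakajimaModel ℓ m) {x : Fin d → ℝ}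
    (hx : x ∈ affineSpan ℝ (nakajimaModel ℓ m)) (hxL : x ∈ stdLattice d) :
    ∃ n : (Fin d → ℝ) → ℤ, ∑ a ∈ σ, n a = 1 ∧ ∑ a ∈ σ, n a • a = x := by
  obtain ⟨hxc, hx0⟩ := mem_coordLattice_of_mem_affineSpan hℓ hx hxL
  rw [← hσ.2, Submodule.mem_span_finset] at hxc
  obtain ⟨n, -, hn⟩ := hxc
  refine ⟨n, ?_, hn⟩
  have h0 := congrFun hn ⟨0, by omega⟩
  rw [hx0, Finset.sum_apply] at h0
  have h1 : ∑ a ∈ σ, (n a • a) ⟨0, by omega⟩ = ∑ a ∈ σ, (n a : ℝ) := by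
    refine Finset.sum_congr rfl fun a ha => ?_
    simp [(nakajimaModel_coord m (hσP ha)).1 ⟨0, by omega⟩ rfl]
  rw [h1] at h0
  exact_mod_cast h0

theorem theorem5p1 {V : Type*} [NormedAddCommGroup V] [NormedSpace ℝ V] [FiniteDimensional ℝ V]
    (L : Submodule ℤ V) [DiscreteTopology L] [IsZLattice ℝ L]
    (P : Set V) (hP : IsNakajimaPolytope L P) :
    ∃ K : Geometry.SimplicialComplex ℝ V, IsBCTriangulation L P K := by
  classical
  obtain ⟨⟨T, -, -, hPT⟩, d, ℓ, m, hℓ, hm, f, hbij, hfP, hlat⟩ := hP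
  have hconv : Convex ℝ P := hPT ▸ convex_convexHull ℝ _
  have hinj := hbij.injOn
  have hPaff := subset_affineSpan ℝ P
  obtain ⟨A₀, ω, U, hA₀, hA₀P, hA₀L, hU, hcov⟩ := exists_nakajimaModel_cover m hℓ hm
  -- Lift the configuration of the model to lattice points of `P`.
  have hlift : (A₀ : Set (Fin d → ℝ)) ⊆ f '' (P ∩ L) := by
    intro a ha
    obtain ⟨x, hx, rfl⟩ : a ∈ f '' P := hfP ▸ hA₀P ha
    have hstd : f x ∈ stdLattice d := by
      rw [stdLattice_eq_coordLattice, mem_coordLattice]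
      exact ⟨(mem_coordLattice.1 (hA₀L _ ha)).1, fun j hj => absurd j.2 (not_lt.2 hj)⟩
    obtain ⟨b, hb, hbx⟩ := hlat.surjOn ⟨hbij.mapsTo (hPaff hx), hstd⟩
    exact ⟨x, ⟨hx, hinj hb.1 (hPaff hx) hbx ▸ hb.2⟩, rfl⟩
  obtain ⟨A, hAPL, rfl⟩ := Finset.subset_set_image_iff.1 hlift
  have hAP : (A : Set V) ⊆ P := fun a ha => (hAPL ha).1
  have hAL : (A : Set V) ⊆ L := fun a ha => (hAPL ha).2
  let cell : ((Fin d → ℝ) →ₗ[ℝ] ℝ) → Finset V := fun u => lowerCell A (ω ∘ f) (u ∘ₗ f.linear)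
  have hcellA : ∀ u, cell u ⊆ A := fun u => lowerCell_subset
  have hcellP : ∀ u, (cell u : Set V) ⊆ P := fun u => (Finset.coe_subset.2 (hcellA u)).trans hAP
  have himage : ∀ u, (cell u).image f = lowerCell (A.image f) ω u :=
    fun u => image_lowerCell_comp f A ω u
  have hcovP : ∀ x ∈ P, ∃ u ∈ U, x ∈ convexHull ℝ (cell u : Set V) := by
    intro x hx
    obtain ⟨u, hu, hxu⟩ := hcov (f x) (hfP ▸ Set.mem_image_of_mem f hx)
    rw [← himage, Finset.mem_convexHull'] at hxu
    obtain ⟨w, hw, hw1, hwx⟩ := hxu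
    obtain ⟨h1, h2⟩ := sum_smul_eq_of_map_eq hinj (hcellP u) hw1 (hPaff hx) hwx
    exact ⟨u, hu, Finset.mem_convexHull'.2
      ⟨fun v => w (f v), fun v hv => hw _ (Finset.mem_image_of_mem f hv), h1, h2⟩⟩
  have hPA : P = convexHull ℝ (A : Set V) := by
    refine Set.Subset.antisymm (fun x hx => ?_) (convexHull_min hAP hconv)
    obtain ⟨u, -, hxu⟩ := hcovP x hx
    exact convexHull_mono (Finset.coe_subset.2 (hcellA u)) hxu
  -- The vertices of each of the chosen cells generate the lattice points of the affine hull.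
  have hgen : ∀ u ∈ U, ∀ y ∈ L, y ∈ affineSpan ℝ P →
      ∃ n : V → ℤ, ∑ v ∈ cell u, n v = 1 ∧ ∑ v ∈ cell u, n v • v = y := by
    intro u hu y hyL hy
    have hfy := hlat.mapsTo ⟨hy, hyL⟩
    obtain ⟨n, hn1, hn⟩ := (hU u hu).exists_sum_eq hℓ
      ((Finset.coe_subset.2 lowerCell_subset).trans hA₀P) hfy.1 hfy.2
    rw [← himage] at hn1 hn
    obtain ⟨h1, h2⟩ := sum_smul_eq_of_map_eq (w := fun a => (n a : ℝ)) hinj (hcellP u)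
      (by exact_mod_cast hn1) hy (by simpa only [Int.cast_smul_eq_zsmul] using hn)
    exact ⟨fun v => n (f v), by exact_mod_cast h1, by
      simpa only [Int.cast_smul_eq_zsmul] using h2⟩
  have hspan : ∀ u ∈ U, affineSpan ℝ (cell u : Set V) = affineSpan ℝ P := by
    intro u hu
    refine le_antisymm (affineSpan_mono ℝ (hcellP u)) ?_
    conv_lhs => rw [hPA, affineSpan_convexHull]
    refine affineSpan_le.2 fun a ha => ?_
    obtain ⟨n, hn1, hn⟩ := hgen u hu a (hAL ha) (hPaff (hAP ha))
    rw [← hn, SetLike.mem_coe]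
    have := sum_smul_mem_affineSpan (s := cell u) subset_rfl (w := fun v => (n v : ℝ))
      (by exact_mod_cast hn1)
    simpa only [Int.cast_smul_eq_zsmul] using this
  have hind : ∀ u ∈ U, AffineIndependent ℝ ((↑) : cell u → V) := by
    intro u hu
    refine AffineIndependent.of_comp f ?_
    have h1 := ((hU u hu).linearIndependent hℓ).affineIndependent
    let φ : cell u ↪ lowerCell (A.image f) ω u :=
      ⟨fun v => ⟨f v, ((mem_lowerCell_comp f).1 v.2).2⟩, fun v v' h => Subtype.ext
        (hinj (hPaff (hcellP u v.2)) (hPaff (hcellP u v'.2)) (congrArg Subtype.val h))⟩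
    exact h1.comp_embedding φ
  have hne : ∀ u, (cell u).Nonempty := fun u => lowerCell_nonempty (Finset.image_nonempty.1 hA₀) _
  rw [hPA]
  refine exists_isBCTriangulation_of_cover (ω ∘ f) (Finset.image_nonempty.1 hA₀) hAL fun x hx => ?_
  rw [← hPA] at hx ⊢
  obtain ⟨u, hu, hxu⟩ := hcovP x hx
  refine ⟨u ∘ₗ f.linear, hxu, hind u hu, ?_, ?_⟩
  · have hcard : Fintype.card (cell u) = (cell u).card - 1 + 1 := by
      rw [Fintype.card_coe]
      have := (hne u).card_pos
      omega
    have := (hind u hu).finrank_vectorSpan hcard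
    rw [Subtype.range_coe_subtype, ← direction_affineSpan] at this
    change Module.finrank ℝ (affineSpan ℝ (cell u : Set V)).direction = _ at this
    rw [hspan u hu, direction_affineSpan] at this
    rw [this]
    exact (Nat.sub_add_cancel (hne u).card_pos).symm
  · refine isBasicSimplex_of_forall_exists_sum L (hne u) ((Finset.coe_subset.2 (hcellA u)).trans hAL)
      (hind u hu) fun y hyL hy => hgen u hu y hyL ?_
    rwa [← hspan u hu]
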